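/- Let $n\ge 1$ and let $S^n=\{x\in\mathbb{R}^{n+1} : \|x\|=1\}$ carry the geodesic metric $d(x,y)=\arccos(x\cdot y)$. For $r>0$ let $\check{C}(S^n;r)$ be the geometric realization (with the weak topology) of the simplicial complex with vertex set $S^n$ whose simplices are the non-empty finite sets $\sigma\subseteq S^n$ with $\bigcap_{x\in\sigma}\{y : d(x,y)<r\}\neq\emptyset$. For $r>0$ let $N_{S^n}(r)$ be the least integer $m\ge 1$ such that $S^n$ is covered by $m$ closed balls of radius $r$ centered at points of $S^n$. For a non-empty topological space $Y$ let $\mathrm{conn}(Y)$ be the greatest integer $k$, if there is one, such that $\pi_i(Y,y)$ is trivial for all $0\le i\le k$ and all $y\in Y$. Then for every $\delta\in(0,\pi)$ the covering numbers $N_{S^n}(\delta)$ and $N_{S^n}(\delta/2)$ are finite, $\mathrm{conn}(\check{C}(S^n;\pi-\delta))$ exists as an integer, and \[\tfrac12 N_{S^n}(\delta)-2\;\le\;\mathrm{conn}\bigl(\check{C}(S^n;\pi-\delta)\bigr)\;\le\; N_{S^n}\!\left(\tfrac{\delta}{2}\right)-2 .\] -/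

import Mathlib

open scoped Topology

noncomputable section

/-! ### The sphere with its geodesic metric -/

/-- The `n`-sphere `{x ∈ ℝⁿ⁺¹ | ‖x‖ = 1}`, as a type of its own: its distance is the geodesic one
below, not the chordal one inherited from `ℝⁿ⁺¹`. -/
def GeodesicSphere (n : ℕ) : Type :=
  {x : EuclideanSpace ℝ (Fin (n + 1)) // ‖x‖ = 1}

namespace GeodesicSphere

/-- The geodesic metric on the sphere: `d(x, y) = arccos (x · y)`. -/
instance instMetricSpace (n : ℕ) : MetricSpace (GeodesicSphere n) where
  dist x y := Real.arccos (inner ℝ x.1 y.1)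
  dist_self x := by
    have h : inner ℝ x.1 x.1 = (1 : ℝ) := by rw [real_inner_self_eq_norm_sq, x.2]; norm_num
    rw [h, Real.arccos_one]
  dist_comm x y := by rw [real_inner_comm]
  dist_triangle x y z := by
    have h := InnerProductGeometry.angle_le_angle_add_angle x.1 y.1 z.1
    simpa [InnerProductGeometry.angle, x.2, y.2, z.2] using h
  eq_of_dist_eq_zero {x y} h := by
    apply Subtype.ext
    have h1 : (1 : ℝ) ≤ inner ℝ x.1 y.1 := Real.arccos_eq_zero.mp h
    have h2 : inner ℝ x.1 y.1 ≤ (1 : ℝ) := by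
      simpa [x.2, y.2] using real_inner_le_norm x.1 y.1
    exact (inner_eq_one_iff_of_norm_eq_one x.2 y.2).mp (le_antisymm h2 h1)

end GeodesicSphere

/-! ### Nerves and Čech complexes -/

/-- The nerve of an indexed family of sets: its faces are the non-empty finite sets of indices
whose members of the family have a common point. -/
def nerveComplex {ι X : Type*} (U : ι → Set X) : PreAbstractSimplicialComplex ι where
  faces := {σ | σ.Nonempty ∧ (⋂ i ∈ σ, U i).Nonempty}
  isRelLowerSet_faces := by
    rintro σ ⟨hσ, z, hz⟩
    refine ⟨hσ, fun τ hτ hne => ⟨hne, z, ?_⟩⟩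
    simp only [Set.mem_iInter] at hz ⊢
    exact fun i hi => hz i (hτ hi)

/-- The intrinsic Čech complex of a metric space at scale `r`: the nerve of all open balls of
radius `r`, indexed by their centres. -/
def cechComplex (X : Type*) [MetricSpace X] (r : ℝ) : PreAbstractSimplicialComplex X :=
  nerveComplex fun x : X => Metric.ball x r

/-! ### Geometric realization -/

/-- The geometric realization of a simplicial complex, in barycentric coordinates: finitely
supported non-negative weights on the vertices, of total weight one, whose support is a face. -/
def GeometricRealization {V : Type*} (K : PreAbstractSimplicialComplex V) : Type _ :=
  {f : V →₀ ℝ // (∀ v, 0 ≤ f v) ∧ (f.sum fun _ a => a) = 1 ∧ f.support ∈ K.faces}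

namespace GeometricRealization

variable {V : Type*} {K : PreAbstractSimplicialComplex V}

/-- The closed simplex spanned by a set `σ` of vertices. -/
def closedSimplex (K : PreAbstractSimplicialComplex V) (σ : Finset V) : Type _ :=
  {f : GeometricRealization K // f.1.support ⊆ σ}

/-- A closed simplex has its Euclidean topology, i.e. that of its barycentric coordinates. -/
instance (σ : Finset V) : TopologicalSpace (closedSimplex K σ) :=
  TopologicalSpace.induced (fun f (v : V) => f.1.1 v) inferInstance

/-- The weak topology: a set is open exactly if its intersection with each closed simplex of the
complex is open in that simplex. -/
instance : TopologicalSpace (GeometricRealization K) :=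
  ⨆ σ ∈ K.faces, TopologicalSpace.coinduced (fun f : closedSimplex K σ => f.1) inferInstance

end GeometricRealization

/-! ### Connectivity -/

/-- `HasConnectivity Y k` says that the connectivity of the non-empty space `Y` is `k`: the
integer `k` is the greatest one such that the homotopy groups (sets, in degree `0`) `π_i(Y, y)`
are trivial for all `i ≤ k` and all base points `y`. In particular `k = -1` if `Y` is not path
connected. -/
def HasConnectivity (Y : Type*) [TopologicalSpace Y] (k : ℤ) : Prop :=
  Nonempty Y ∧ IsGreatest {k : ℤ | ∀ i : ℕ, (i : ℤ) ≤ k → ∀ y : Y, Subsingleton (π_ i Y y)} k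

end

/-!
Call two points of the sphere adjacent if their distance exceeds `δ`. Since
`d(x, -z) = π - d(x, z)`, a finite set of points is a face of the Čech complex at scale `π - δ`
exactly if its points have a common neighbour, that is, if the closed `δ`-balls around them do not
cover the sphere (`GeodesicSphere.mem_faces_cechComplex_iff`). Both bounds follow from this.

*Lower bound.* Every non-empty set of fewer than `N(δ)` points is a face, so the complex contains
the full `(N(δ) - 2)`-skeleton of a simplex, and its connectivity is at least `N(δ) - 3`, which is
at least `N(δ) / 2 - 2` because `N(δ) ≥ 2`. Indeed, a map of the `i`-cube is approximated by one
which uses at most `i + 1` vertices at each point, and this one can be coned off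
(`GeometricRealization.subsingleton_homotopyGroup_of_skeleton`). The approximation comes from the
partition of unity of order `i + 1` given by the Kuhn triangulation of the cube.

*Upper bound.* A cover by closed balls of radius `δ / 2` is a proper colouring of the graph, and the
Čech complex is its neighbourhood complex, so the bound is an instance of Lovász's theorem
(`not_forall_subsingleton_homotopyGroup_of_coloring`): the neighbourhood complex of a graph with `N`
colours is not `(N - 1)`-connected. An *edge map* is a pair of maps `u`, `v` to the full simplex such
that the supports of `u x` and `v x` are always completely joined. If the neighbourhood complex is
`(N - 1)`-connected, then, beginning with an edge and going from hemisphere to hemisphere, one finds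
an edge map on the `N`-cube whose components are interchanged by the antipodal map of the boundary
(`IsEdgeMap.exists_extension`). The difference of the colour distributions of `u` and `v` is then a
nowhere vanishing map to `ℝᴺ`, odd on the boundary of the cube. As in the theorem of Borsuk and Ulam
this is impossible: label each point of a fine grid by a coordinate of largest absolute value and its
sign; the parity of the number of simplices whose signs alternate is passed on from each cube to the
next (`fanParity_succ`, after Ky Fan), is odd in dimension `0`, and is even in dimension `N`, where
there are not enough labels.
-/

noncomputable section

/-! ### Cochains on lists and the prism operator -/

/-- The coboundary modulo two of a cochain on lists: `listCoboundary f l` is the sum of `f` over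
all lists obtained from `l` by deleting one entry. -/
def listCoboundary {P : Type*} (f : List P → ZMod 2) : List P → ZMod 2
  | [] => 0
  | x :: l => f l + listCoboundary (fun m => f (x :: m)) l

/-- The dual of the prism operator: the sum of `f` over the lists
`(s, x₀), …, (s, xₖ), (s + 1, xₖ), …, (s + 1, xⱼ)` which triangulate the product of a simplex
`x₀, …, xⱼ` with the segment from `s` to `s + 1`. -/
def prismSum {i : ℕ} (s : ℕ) (f : List (Fin (i + 1) → ℕ) → ZMod 2) : List (Fin i → ℕ) → ZMod 2
  | [] => 0
  | x :: l =>
      f ((Fin.cons s x : Fin (i + 1) → ℕ) :: (Fin.cons (s + 1) x : Fin (i + 1) → ℕ) ::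
        l.map fun y => (Fin.cons (s + 1) y : Fin (i + 1) → ℕ)) +
      prismSum s (fun m => f ((Fin.cons s x : Fin (i + 1) → ℕ) :: m)) l

/-- The sum of a cochain `f` over the top-dimensional simplices of the standard (Kuhn)
triangulation of the grid `{0, …, M}ⁱ`, which arises by iterating the prism construction. -/
def gridSum (M : ℕ) : (i : ℕ) → (List (Fin i → ℕ) → ZMod 2) → ZMod 2
  | 0, f => f [default]
  | i + 1, f => ∑ s ∈ Finset.range M, gridSum M i (prismSum s f)

theorem zmod_two_add_self (a : ZMod 2) : a + a = 0 := CharTwo.add_self_eq_zero a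

section Coboundary

variable {P Q : Type*}

theorem listCoboundary_add (f g : List P → ZMod 2) (l : List P) :
    listCoboundary (fun m => f m + g m) l = listCoboundary f l + listCoboundary g l := by
  induction l generalizing f g with
  | nil => simp [listCoboundary]
  | cons x l ih => simp only [listCoboundary, ih]; ring

theorem listCoboundary_const_mul (c : ZMod 2) (f : List P → ZMod 2) (l : List P) :
    listCoboundary (fun m => c * f m) l = c * listCoboundary f l := by
  induction l generalizing f with
  | nil => simp [listCoboundary]
  | cons x l ih => simp only [listCoboundary, ih, mul_add]

theorem listCoboundary_congr {f g : List P → ZMod 2} {l : List P}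
    (h : ∀ m, m.Sublist l → f m = g m) : listCoboundary f l = listCoboundary g l := by
  induction l generalizing f g with
  | nil => rfl
  | cons x l ih =>
    simp only [listCoboundary]
    rw [h l (List.sublist_cons_self x l), ih fun m hm => h _ (hm.cons_cons x)]

theorem listCoboundary_zero (l : List P) : listCoboundary (fun _ => 0) l = 0 := by
  induction l with
  | nil => rfl
  | cons x l ih => simp [listCoboundary, ih]

theorem listCoboundary_map (φ : P → Q) (f : List Q → ZMod 2) (l : List P) :
    listCoboundary (fun m => f (m.map φ)) l = listCoboundary f (l.map φ) := by
  induction l generalizing f with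
  | nil => rfl
  | cons x l ih =>
    simp only [listCoboundary, List.map_cons]
    rw [ih fun m => f (φ x :: m)]

theorem listCoboundary_perm {f : List P → ZMod 2} (hf : ∀ l l', l.Perm l' → f l = f l')
    {l l' : List P} (h : l.Perm l') : listCoboundary f l = listCoboundary f l' := by
  induction h generalizing f with
  | nil => rfl
  | cons x h ih =>
    simp only [listCoboundary]
    rw [hf _ _ h, ih fun a b hab => hf _ _ (hab.cons x)]
  | swap x y l =>
    simp only [listCoboundary]
    rw [show (fun m => f (y :: x :: m)) = fun m => f (x :: y :: m) from
      funext fun m => hf _ _ (List.Perm.swap x y m)]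
    ring
  | trans _ _ ih₁ ih₂ => rw [ih₁ hf, ih₂ hf]

end Coboundary

section Prism

variable {i : ℕ}

theorem prismSum_add (s : ℕ) (f g : List (Fin (i + 1) → ℕ) → ZMod 2) (l : List (Fin i → ℕ)) :
    prismSum s (fun m => f m + g m) l = prismSum s f l + prismSum s g l := by
  induction l generalizing f g with
  | nil => simp [prismSum]
  | cons x l ih => simp only [prismSum, ih]; ring

theorem prismSum_congr {s : ℕ} {f g : List (Fin (i + 1) → ℕ) → ZMod 2} {l : List (Fin i → ℕ)}
    (h : ∀ m : List (Fin (i + 1) → ℕ), m.length = l.length + 1 →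
      (∀ y ∈ m, ∃ x ∈ l, y = Fin.cons s x ∨ y = Fin.cons (s + 1) x) → f m = g m) :
    prismSum s f l = prismSum s g l := by
  induction l generalizing f g with
  | nil => rfl
  | cons x l ih =>
    simp only [prismSum]
    congr 1
    · apply h
      · simp
      · intro y hy
        simp only [List.mem_cons, List.mem_map] at hy
        rcases hy with rfl | rfl | ⟨z, hz, rfl⟩
        · exact ⟨x, by simp, Or.inl rfl⟩
        · exact ⟨x, by simp, Or.inr rfl⟩
        · exact ⟨z, by simp [hz], Or.inr rfl⟩
    · apply ih
      intro m hm hm'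
      apply h
      · simp [hm]
      · intro y hy
        rcases List.mem_cons.1 hy with rfl | hy
        · exact ⟨x, by simp, Or.inl rfl⟩
        · obtain ⟨z, hz, h⟩ := hm' y hy
          exact ⟨z, by simp [hz], h⟩

theorem prismSum_zero (s : ℕ) (l : List (Fin i → ℕ)) :
    prismSum s (fun _ => 0) l = 0 := by
  induction l with
  | nil => rfl
  | cons x l ih => simp [prismSum, ih]

/-- The prism operator is a chain homotopy between the bottom and the top of the prism. -/
theorem listCoboundary_prismSum_add (s : ℕ) (f : List (Fin (i + 1) → ℕ) → ZMod 2)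
    (l : List (Fin i → ℕ)) :
    listCoboundary (prismSum s f) l + prismSum s (listCoboundary f) l =
      f (l.map (Fin.cons s)) + f (l.map (Fin.cons (s + 1))) := by
  induction l generalizing f with
  | nil => simp [listCoboundary, prismSum, zmod_two_add_self]
  | cons x l ih =>
    have h := ih fun m => f ((Fin.cons s x : Fin (i + 1) → ℕ) :: m)
    simp only [listCoboundary, prismSum, List.map_cons, listCoboundary_add, prismSum_add]
    have e := listCoboundary_map (fun y => (Fin.cons (s + 1) y : Fin (i + 1) → ℕ))
      (fun m => f ((Fin.cons s x : Fin (i + 1) → ℕ) :: (Fin.cons (s + 1) x : Fin (i + 1) → ℕ) :: m))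
      l
    rw [e]
    have h2 : (2 : ZMod 2) = 0 := rfl
    linear_combination h + h2 * (f ((Fin.cons s x : Fin (i + 1) → ℕ) ::
        l.map (Fin.cons (s + 1))) + prismSum s f l +
      listCoboundary (fun m => f ((Fin.cons s x : Fin (i + 1) → ℕ) ::
        (Fin.cons (s + 1) x : Fin (i + 1) → ℕ) :: m)) (l.map fun y => Fin.cons (s + 1) y))

theorem prismSum_append_singleton (s : ℕ) (f : List (Fin (i + 1) → ℕ) → ZMod 2)
    (l : List (Fin i → ℕ)) (x : Fin i → ℕ) :
    prismSum s f (l ++ [x]) =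
      f (l.map (Fin.cons s) ++ [(Fin.cons s x : Fin (i + 1) → ℕ), Fin.cons (s + 1) x]) +
      prismSum s (fun m => f (m ++ [(Fin.cons (s + 1) x : Fin (i + 1) → ℕ)])) l := by
  induction l generalizing f with
  | nil => simp [prismSum]
  | cons y l ih =>
    simp only [List.cons_append, prismSum, ih, List.map_cons, List.map_append, List.map_nil]
    ring

/-- A prism over a list of points at which a labelling does not change along the segment gives
only degenerate lists of labels. -/
theorem prismSum_eq_zero_of_label_eq {Q : Type*} {s : ℕ} (φ : (Fin (i + 1) → ℕ) → Q)
    (f : List Q → ZMod 2) (hf : ∀ a m m', f (m ++ a :: a :: m') = 0) (l : List (Fin i → ℕ))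
    (h : ∀ x ∈ l, φ (Fin.cons s x) = φ (Fin.cons (s + 1) x)) :
    prismSum s (fun m => f (m.map φ)) l = 0 := by
  suffices ∀ p : List Q, prismSum s (fun m => f (p ++ m.map φ)) l = 0 from this []
  induction l with
  | nil => exact fun _ => rfl
  | cons x l ih =>
    intro p
    simp only [prismSum, List.map_cons]
    rw [h x (by simp), hf, zero_add, ← ih (fun y hy => h y (by simp [hy]))
      (p ++ [φ (Fin.cons (s + 1) x)])]
    simp

end Prism

section Grid

variable {i M : ℕ}

/-- Lists of `i + 1` pairwise adjacent points of the grid `{0, …, M}ⁱ`. -/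
def IsGridSimplex (M : ℕ) {i : ℕ} (l : List (Fin i → ℕ)) : Prop :=
  l.length = i + 1 ∧ (∀ x ∈ l, ∀ j, x j ≤ M) ∧ ∀ x ∈ l, ∀ y ∈ l, ∀ j, x j ≤ y j + 1

theorem gridSum_congr {f g : List (Fin i → ℕ) → ZMod 2}
    (h : ∀ l, IsGridSimplex M l → f l = g l) : gridSum M i f = gridSum M i g := by
  induction i with
  | zero => exact h _ ⟨rfl, fun _ _ j => j.elim0, fun _ _ _ _ j => j.elim0⟩
  | succ i ih =>
    refine Finset.sum_congr rfl fun s hs => ih fun l hl => prismSum_congr fun m hm hm' => h _ ?_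
    rw [Finset.mem_range] at hs
    refine ⟨by rw [hm, hl.1], fun y hy => ?_, fun y hy z hz => ?_⟩
    · obtain ⟨x, hx, rfl | rfl⟩ := hm' y hy <;> intro j <;>
        refine Fin.cases ?_ (fun j => ?_) j
      · simp; omega
      · simpa using hl.2.1 x hx j
      · simp; omega
      · simpa using hl.2.1 x hx j
    · obtain ⟨x, hx, hy⟩ := hm' y hy
      obtain ⟨x', hx', hz⟩ := hm' z hz
      intro j
      refine Fin.cases ?_ (fun j => ?_) j
      · rcases hy with rfl | rfl <;> rcases hz with rfl | rfl <;>
          simp only [Fin.cons_zero] <;> omega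
      · have := hl.2.2 x hx x' hx' j
        rcases hy with rfl | rfl <;> rcases hz with rfl | rfl <;> simpa using this

theorem gridSum_add (f g : List (Fin i → ℕ) → ZMod 2) :
    gridSum M i (fun l => f l + g l) = gridSum M i f + gridSum M i g := by
  induction i with
  | zero => rfl
  | succ i ih =>
    simp only [gridSum]
    rw [← Finset.sum_add_distrib]
    refine Finset.sum_congr rfl fun s _ => ?_
    rw [← ih]
    congr 1
    exact funext fun l => prismSum_add s f g l

theorem gridSum_zero : gridSum M i (fun _ => 0) = 0 := by
  have h := gridSum_add (M := M) (i := i) (fun _ => 0) (fun _ => 0)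
  simpa using h

/-- The boundary of the triangulated cube of dimension `i + 1` consists of its bottom, its top,
and the prisms over the boundary of the cube of dimension `i`. -/
theorem gridSum_listCoboundary (f : List (Fin (i + 1) → ℕ) → ZMod 2) :
    gridSum M (i + 1) (listCoboundary f) =
      gridSum M i (fun l => f (l.map (Fin.cons 0))) +
      gridSum M i (fun l => f (l.map (Fin.cons M))) +
      ∑ s ∈ Finset.range M, gridSum M i (listCoboundary (prismSum s f)) := by
  have h2 : (2 : ZMod 2) = 0 := rfl
  have key : ∀ s, gridSum M i (prismSum s (listCoboundary f)) =
      (gridSum M i (fun l => f (l.map (Fin.cons (s + 1)))) -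
        gridSum M i (fun l => f (l.map (Fin.cons s)))) +
        gridSum M i (listCoboundary (prismSum s f)) := by
    intro s
    have e : prismSum s (listCoboundary f) = fun l =>
        (f (l.map (Fin.cons s)) + f (l.map (Fin.cons (s + 1)))) +
          listCoboundary (prismSum s f) l := by
      funext l
      rw [← listCoboundary_prismSum_add]
      linear_combination -h2 * listCoboundary (prismSum s f) l
    rw [e, gridSum_add, gridSum_add (fun l => f (l.map (Fin.cons s)))]
    linear_combination h2 * gridSum M i (fun l => f (l.map (Fin.cons s)))
  simp only [gridSum]
  rw [Finset.sum_congr rfl fun s _ => key s, Finset.sum_add_distrib, Finset.sum_range_sub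
    (fun s => gridSum M i (fun l => f (l.map (Fin.cons s))))]
  linear_combination -h2 * gridSum M i (fun l => f (l.map (Fin.cons 0)))

/-- Stokes' theorem for cochains which vanish on the facets of the grid. -/
theorem gridSum_listCoboundary_eq_zero (h : List (Fin i → ℕ) → ZMod 2) (h_nil : h [] = 0)
    (h_facet : ∀ l j, (∀ x ∈ l, ∀ k, x k ≤ M) → (∀ x ∈ l, x j = 0) ∨ (∀ x ∈ l, x j = M) →
      h l = 0) :
    gridSum M i (listCoboundary h) = 0 := by
  induction i with
  | zero => simp [gridSum, listCoboundary, h_nil]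
  | succ i ih =>
    have hb : ∀ (x : Fin i → ℕ) s, s ≤ M → (∀ k, x k ≤ M) →
        ∀ k, (Fin.cons s x : Fin (i + 1) → ℕ) k ≤ M := fun x s hs hx k => by
      refine Fin.cases ?_ (fun k => ?_) k
      · exact hs
      · exact hx k
    rw [gridSum_listCoboundary]
    have h0 : gridSum M i (fun l => h (l.map (Fin.cons 0))) = 0 := by
      rw [← gridSum_zero (M := M) (i := i)]
      refine gridSum_congr fun l hl => h_facet _ 0 ?_ (Or.inl (by simp))
      simp only [List.mem_map, forall_exists_index, and_imp, forall_apply_eq_imp_iff₂]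
      exact fun x hx => hb x _ (Nat.zero_le M) (hl.2.1 x hx)
    have h1 : gridSum M i (fun l => h (l.map (Fin.cons M))) = 0 := by
      rw [← gridSum_zero (M := M) (i := i)]
      refine gridSum_congr fun l hl => h_facet _ 0 ?_ (Or.inr (by simp))
      simp only [List.mem_map, forall_exists_index, and_imp, forall_apply_eq_imp_iff₂]
      exact fun x hx => hb x _ le_rfl (hl.2.1 x hx)
    rw [h0, h1, zero_add, zero_add]
    refine Finset.sum_eq_zero fun s hs => ih _ rfl fun l j hlM hl => ?_
    rw [Finset.mem_range] at hs
    rw [← prismSum_zero s l]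
    refine prismSum_congr fun m _ hm => h_facet m j.succ (fun y hy => ?_) ?_
    · obtain ⟨x, hx, rfl | rfl⟩ := hm y hy
      · exact hb x _ hs.le (hlM x hx)
      · exact hb x _ hs (hlM x hx)
    · refine hl.imp (fun hl y hy => ?_) (fun hl y hy => ?_) <;>
        obtain ⟨x, hx, rfl | rfl⟩ := hm y hy <;> simp [hl x hx]

/-- The central reflection of the grid `{0, …, M}ⁱ`. -/
def gridReflect (M : ℕ) {i : ℕ} (x : Fin i → ℕ) : Fin i → ℕ := fun j => M - x j

theorem gridReflect_cons (s : ℕ) (x : Fin i → ℕ) :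
    gridReflect M (Fin.cons s x : Fin (i + 1) → ℕ) = Fin.cons (M - s) (gridReflect M x) := by
  funext j
  refine Fin.cases ?_ (fun j => ?_) j <;> simp [gridReflect]

theorem prismSum_reflect {s : ℕ} (hs : s < M) (f : List (Fin (i + 1) → ℕ) → ZMod 2)
    (l : List (Fin i → ℕ)) :
    prismSum s (fun m => f (m.map (gridReflect M)).reverse) l =
      prismSum (M - 1 - s) f (l.map (gridReflect M)).reverse := by
  have e1 : M - (s + 1) = M - 1 - s := by omega
  have e2 : M - s = M - 1 - s + 1 := by omega
  induction l generalizing f with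
  | nil => rfl
  | cons x l ih =>
    simp only [List.map_cons, List.reverse_cons, prismSum_append_singleton]
    rw [← ih (fun m => f (m ++ [(Fin.cons (M - 1 - s + 1) (gridReflect M x) :
      Fin (i + 1) → ℕ)]))]
    simp only [prismSum, List.map_cons, List.reverse_cons, gridReflect_cons, e1, e2]
    congr 2
    simp [List.map_reverse, Function.comp_def, gridReflect_cons, e1]

/-- The triangulation of the grid is invariant under the central reflection. -/
theorem gridSum_reflect (f : List (Fin i → ℕ) → ZMod 2) :
    gridSum M i (fun l => f (l.map (gridReflect M)).reverse) = gridSum M i f := by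
  induction i with
  | zero =>
    simp only [gridSum, List.map_cons, List.map_nil, List.reverse_singleton]
    congr 2
    exact Subsingleton.elim _ _
  | succ i ih =>
    simp only [gridSum]
    rw [← Finset.sum_range_reflect (fun s => gridSum M i (prismSum s f))]
    refine Finset.sum_congr rfl fun s hs => ?_
    rw [← ih (prismSum (M - 1 - s) f)]
    congr 1
    exact funext fun l => prismSum_reflect (Finset.mem_range.1 hs) f l

end Grid

/-! ### The alternating cochains of Ky Fan -/

section Alternating

variable {N : ℕ}

/-- The sign of a label, in `ZMod 2`. -/
def labelSign (a : Fin N × Bool) : ZMod 2 := if a.2 then 1 else 0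

/-- The antipodal label. -/
def labelNeg (a : Fin N × Bool) : Fin N × Bool := (a.1, !a.2)

/-- The number modulo two which tells whether the signs of `x :: l` alternate. -/
def alternates : Fin N × Bool → List (Fin N × Bool) → ZMod 2
  | _, [] => 1
  | x, y :: l => (labelSign x + labelSign y) * alternates y l

/-- Whether the signs of a list alternate, beginning with the sign opposite to `b`. -/
def alternatesFrom (b : ZMod 2) : List (Fin N × Bool) → ZMod 2
  | [] => 0
  | x :: l => (b + labelSign x) * alternates x l

/-- The list of labels sorted by magnitude. -/
def labelSort (l : List (Fin N × Bool)) : List (Fin N × Bool) :=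
  l.insertionSort fun a b => a.1 ≤ b.1

/-- Ky Fan's alternating cochain: whether the labels have distinct magnitudes and, in the order of
their magnitudes, alternating signs, beginning with the sign opposite to `b`. -/
def fanCochain (b : ZMod 2) (l : List (Fin N × Bool)) : ZMod 2 :=
  if (l.map Prod.fst).Nodup then alternatesFrom b (labelSort l) else 0

/-- A list of labels without a complementary pair. -/
def ComplementaryFree (l : List (Fin N × Bool)) : Prop :=
  ∀ a ∈ l, labelNeg a ∉ l

theorem labelSort_perm (l : List (Fin N × Bool)) : (labelSort l).Perm l :=
  List.perm_insertionSort _ l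

theorem labelSort_pairwise {l : List (Fin N × Bool)} (h : (l.map Prod.fst).Nodup) :
    (labelSort l).Pairwise fun a b => a.1 < b.1 := by
  have hs : (labelSort l).Pairwise fun a b => a.1 ≤ b.1 := by
    have : Std.Total (fun a b : Fin N × Bool => a.1 ≤ b.1) := ⟨fun a b => le_total _ _⟩
    have : IsTrans (Fin N × Bool) (fun a b => a.1 ≤ b.1) := ⟨fun a b c => le_trans⟩
    exact List.pairwise_insertionSort _ l
  have hn : (labelSort l).Pairwise fun a b => a.1 ≠ b.1 := by
    rw [← ((labelSort_perm l).map Prod.fst).nodup_iff] at h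
    exact List.pairwise_map.1 h
  exact hs.imp₂ (fun _ _ h₁ h₂ => lt_of_le_of_ne h₁ h₂) hn

theorem labelSort_eq_of_perm {l l' : List (Fin N × Bool)} (h : l.Perm l')
    (h' : l'.Pairwise fun a b => a.1 < b.1) : labelSort l = l' := by
  have hn : (l'.map Prod.fst).Nodup := List.pairwise_map.2 (h'.imp fun h => h.ne)
  refine List.Perm.eq_of_pairwise (le := fun a b => a.1 < b.1)
    (fun a b _ _ h₁ h₂ => absurd (h₁.trans h₂) (lt_irrefl _))
    (labelSort_pairwise (((h.map Prod.fst).nodup_iff).2 hn)) h' ((labelSort_perm l).trans h)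

theorem fanCochain_perm (b : ZMod 2) {l l' : List (Fin N × Bool)} (h : l.Perm l') :
    fanCochain b l = fanCochain b l' := by
  unfold fanCochain
  by_cases hn : (l'.map Prod.fst).Nodup
  · rw [if_pos hn, if_pos ((h.map _).nodup_iff.2 hn),
      labelSort_eq_of_perm (h.trans (labelSort_perm l').symm) (labelSort_pairwise hn)]
  · rw [if_neg hn, if_neg fun h' => hn ((h.map _).nodup_iff.1 h')]

theorem fanCochain_of_pairwise (b : ZMod 2) {l : List (Fin N × Bool)}
    (h : l.Pairwise fun a b => a.1 < b.1) : fanCochain b l = alternatesFrom b l := by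
  have hn : (l.map Prod.fst).Nodup := List.pairwise_map.2 (h.imp fun h => h.ne)
  rw [fanCochain, if_pos hn, labelSort_eq_of_perm (List.Perm.refl l) h]

theorem fanCochain_duplicate (b : ZMod 2) (a : Fin N × Bool) (m m' : List (Fin N × Bool)) :
    fanCochain b (m ++ a :: a :: m') = 0 := by
  rw [fanCochain, if_neg]
  simp [List.nodup_append]

theorem ComplementaryFree.nodup_map_fst {l : List (Fin N × Bool)} (h : ComplementaryFree l)
    (hl : l.Nodup) : (l.map Prod.fst).Nodup := by
  refine List.Nodup.map_on (fun x hx y hy hxy => ?_) hl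
  by_contra hne
  refine h x hx ?_
  have : labelNeg x = y := by
    rcases x with ⟨j, s⟩
    rcases y with ⟨j', s'⟩
    simp only at hxy
    subst hxy
    rcases s <;> rcases s' <;> simp_all [labelNeg]
  rwa [this]

theorem fanCochain_eq_zero_of_length {b : ZMod 2} {l : List (Fin N × Bool)}
    (hl : N < l.length) : fanCochain b l = 0 := by
  rw [fanCochain, if_neg]
  intro h
  have := h.length_le_card
  simp at this
  omega

theorem labelSign_labelNeg (a : Fin N × Bool) : labelSign (labelNeg a) = 1 + labelSign a := by
  rcases a with ⟨j, _ | _⟩ <;> simp [labelSign, labelNeg]; rfl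

theorem alternates_map_labelNeg (x : Fin N × Bool) (l : List (Fin N × Bool)) :
    alternates (labelNeg x) (l.map labelNeg) = alternates x l := by
  induction l generalizing x with
  | nil => rfl
  | cons y l ih =>
    simp only [List.map_cons, alternates, ih, labelSign_labelNeg]
    have h2 : (2 : ZMod 2) = 0 := rfl
    linear_combination h2 * alternates y l

theorem fanCochain_map_labelNeg (l : List (Fin N × Bool)) :
    fanCochain 0 (l.map labelNeg) = fanCochain 1 l := by
  have e : (l.map labelNeg).map Prod.fst = l.map Prod.fst := by
    simp [labelNeg, Function.comp_def]
  unfold fanCochain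
  rw [e]
  split_ifs with h
  · have hp := labelSort_pairwise h
    rw [labelSort_eq_of_perm ((labelSort_perm l).symm.map labelNeg)
      (List.pairwise_map.2 hp)]
    rcases labelSort l with _ | ⟨x, m⟩
    · rfl
    · simp [alternatesFrom, alternates_map_labelNeg, labelSign_labelNeg]
  · rfl

theorem listCoboundary_alternates (x y : Fin N × Bool) (l : List (Fin N × Bool)) :
    listCoboundary (alternates x) (y :: l) = alternates y l := by
  have h2 : (2 : ZMod 2) = 0 := rfl
  induction l generalizing x y with
  | nil => simp [listCoboundary, alternates]
  | cons z l ih =>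
    rw [listCoboundary]
    simp only [alternates]
    rw [listCoboundary_const_mul, ih]
    linear_combination h2 * labelSign x * alternates z l

theorem listCoboundary_alternatesFrom (x y : Fin N × Bool) (l : List (Fin N × Bool)) :
    listCoboundary (alternatesFrom 0) (x :: y :: l) =
      alternatesFrom 0 (x :: y :: l) + alternatesFrom 1 (x :: y :: l) := by
  have h2 : (2 : ZMod 2) = 0 := rfl
  rw [listCoboundary]
  simp only [alternatesFrom]
  rw [listCoboundary_const_mul, listCoboundary_alternates]
  simp only [alternates]
  linear_combination -h2 * labelSign x * (labelSign x + labelSign y) * alternates y l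

/-- Ky Fan's identity: the coboundary of the alternating cochain of one sign is the sum of the
alternating cochains of both signs. -/
theorem listCoboundary_fanCochain {l : List (Fin N × Bool)} (h : ComplementaryFree l)
    (hl : 2 ≤ l.length) :
    listCoboundary (fanCochain 0) l = fanCochain 0 l + fanCochain 1 l := by
  by_cases hn : l.Nodup
  · have hp := labelSort_pairwise (h.nodup_map_fst hn)
    rw [← fanCochain_perm 0 (labelSort_perm l), ← fanCochain_perm 1 (labelSort_perm l),
      ← listCoboundary_perm (fun _ _ => fanCochain_perm 0) (labelSort_perm l),
      listCoboundary_congr fun m hm => fanCochain_of_pairwise 0 (hp.sublist hm),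
      fanCochain_of_pairwise 0 hp, fanCochain_of_pairwise 1 hp]
    rw [← (labelSort_perm l).length_eq] at hl
    match labelSort l, hl with
    | x :: y :: m, _ => exact listCoboundary_alternatesFrom x y m
  · -- A repeated label: the two deletions of it cancel, all other terms are degenerate.
    obtain ⟨a, ha⟩ := List.exists_duplicate_iff_not_nodup.2 hn
    obtain ⟨m, hm⟩ := (List.duplicate_iff_sublist.1 ha).exists_perm_append
    have h0 : ∀ b m', fanCochain b (a :: a :: m') = 0 := fun b m' => fanCochain_duplicate b a [] m'
    rw [fanCochain_perm 0 hm, fanCochain_perm 1 hm,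
      listCoboundary_perm (fun _ _ => fanCochain_perm 0) hm]
    simp only [List.cons_append, List.nil_append, listCoboundary, h0, listCoboundary_zero]
    rw [add_zero, zmod_two_add_self, add_zero]

end Alternating

/-! ### Labels of non-zero vectors -/

section Label

variable {N : ℕ}

theorem exists_forall_abs_le [NeZero N] (w : Fin N → ℝ) : ∃ j, ∀ k, |w k| ≤ |w j| := by
  obtain ⟨j, -, hj⟩ := Finset.exists_max_image Finset.univ (fun k => |w k|) ⟨0, Finset.mem_univ _⟩
  exact ⟨j, fun k => hj k (Finset.mem_univ k)⟩

/-- The label of a vector: an index at which the absolute value of its coordinate is largest (the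
choice depends on the absolute values only), and the sign of this coordinate. -/
def vectorLabel [NeZero N] (w : Fin N → ℝ) : Fin N × Bool :=
  let j := Classical.epsilon fun j => ∀ k, (fun k => |w k|) k ≤ (fun k => |w k|) j
  (j, decide (0 < w j))

theorem abs_le_abs_vectorLabel [NeZero N] (w : Fin N → ℝ) (k : Fin N) :
    |w k| ≤ |w (vectorLabel w).1| :=
  Classical.epsilon_spec (exists_forall_abs_le w) k

theorem norm_eq_abs_vectorLabel [NeZero N] (w : Fin N → ℝ) : ‖w‖ = |w (vectorLabel w).1| :=
  le_antisymm ((pi_norm_le_iff_of_nonneg (abs_nonneg _)).2 (abs_le_abs_vectorLabel w))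
    (norm_le_pi_norm w _)

theorem vectorLabel_neg [NeZero N] {w : Fin N → ℝ} (hw : w ≠ 0) :
    vectorLabel (-w) = labelNeg (vectorLabel w) := by
  have e : (vectorLabel (-w)).1 = (vectorLabel w).1 := by simp [vectorLabel]
  have h : w (vectorLabel w).1 ≠ 0 := by
    rw [← abs_pos, ← norm_eq_abs_vectorLabel]
    exact norm_pos_iff.2 hw
  refine Prod.ext e ?_
  change decide (0 < (-w) (vectorLabel (-w)).1) = !decide (0 < w (vectorLabel w).1)
  rw [e]
  rcases lt_or_gt_of_ne h with h | h
  · simp [h, h.le]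
  · simp [h, h.le]

theorem lt_dist_of_vectorLabel_eq_labelNeg [NeZero N] {w w' : Fin N → ℝ} {m : ℝ} (hm : 0 < m)
    (hw : m ≤ ‖w‖) (hw' : m ≤ ‖w'‖) (h : vectorLabel w' = labelNeg (vectorLabel w)) :
    m < dist w w' := by
  rw [norm_eq_abs_vectorLabel] at hw hw'
  have h1 : (vectorLabel w').1 = (vectorLabel w).1 := by rw [h]; rfl
  have h2 : decide (0 < w' (vectorLabel w').1) = !decide (0 < w (vectorLabel w).1) := by
    change (vectorLabel w').2 = !(vectorLabel w).2
    rw [h]; rfl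
  rw [h1] at h2 hw'
  have h3 := dist_le_pi_dist w w' (vectorLabel w).1
  rw [Real.dist_eq] at h3
  generalize w (vectorLabel w).1 = a at *
  generalize w' (vectorLabel w).1 = b at *
  by_cases ha : 0 < a
  · have hb : b ≤ 0 := by simpa [ha] using h2
    rw [abs_of_pos ha] at hw
    rw [abs_of_pos (by linarith)] at h3
    rw [abs_of_nonpos hb] at hw'
    linarith
  · have hb : 0 < b := by simpa [ha] using h2
    rw [abs_of_nonpos (not_lt.1 ha)] at hw
    rw [abs_of_pos hb] at hw'
    rw [abs_sub_comm, abs_of_pos (by linarith)] at h3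
    linarith

end Label

/-! ### The parity of a map of a cube -/

section Parity

variable {N i : ℕ}

/-- The point of the cube `[-1, 1]ⁱ` which corresponds to a point of the grid `{0, …, M}ⁱ`. -/
def gridPoint (M : ℕ) (x : Fin i → ℕ) : Fin i → ℝ := fun j => 2 * (x j / M) - 1

theorem gridPoint_cons (M s : ℕ) (x : Fin i → ℕ) :
    gridPoint M (Fin.cons s x : Fin (i + 1) → ℕ) = Fin.cons (2 * ((s : ℝ) / M) - 1)
      (gridPoint M x) := by
  funext j
  refine Fin.cases ?_ (fun j => ?_) j <;> simp [gridPoint]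

theorem gridPoint_reflect {M : ℕ} (hM : 0 < M) {x : Fin i → ℕ} (hx : ∀ j, x j ≤ M) :
    gridPoint M (gridReflect M x) = -gridPoint M x := by
  funext j
  have : (M : ℝ) ≠ 0 := by positivity
  simp only [gridPoint, gridReflect, Pi.neg_apply, Nat.cast_sub (hx j)]
  field_simp
  ring

theorem norm_gridPoint_le {M : ℕ} {x : Fin i → ℕ} (hx : ∀ j, x j ≤ M) :
    ‖gridPoint M x‖ ≤ 1 := by
  rw [pi_norm_le_iff_of_nonneg zero_le_one]
  intro j
  have h1 : (x j : ℝ) ≤ M := by exact_mod_cast hx j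
  have h2 : (x j : ℝ) / M ≤ 1 := div_le_one_of_le₀ h1 (by positivity)
  have h3 : 0 ≤ (x j : ℝ) / M := by positivity
  rw [Real.norm_eq_abs, abs_le, gridPoint]
  constructor <;> linarith

theorem dist_gridPoint_le {M : ℕ} (hM : 0 < M) {x y : Fin i → ℕ} (h : ∀ j, x j ≤ y j + 1)
    (h' : ∀ j, y j ≤ x j + 1) : dist (gridPoint M x) (gridPoint M y) ≤ 2 / M := by
  rw [dist_pi_le_iff (by positivity)]
  intro j
  have h1 : (x j : ℝ) ≤ y j + 1 := by exact_mod_cast h j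
  have h2 : (y j : ℝ) ≤ x j + 1 := by exact_mod_cast h' j
  have hM' : (0 : ℝ) < M := by positivity
  have e : gridPoint M x j - gridPoint M y j = 2 / M * ((x j : ℝ) - y j) := by
    simp only [gridPoint]
    field_simp
    ring
  rw [Real.dist_eq, e, abs_mul, abs_of_pos (by positivity)]
  refine mul_le_of_le_one_right (by positivity) ?_
  rw [abs_le]
  constructor <;> linarith

/-- The labels of a map to `ℝᴺ` at the points of a list of grid points. -/
def gridLabels [NeZero N] (M : ℕ) (G : (Fin i → ℝ) → Fin N → ℝ) (l : List (Fin i → ℕ)) :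
    List (Fin N × Bool) :=
  l.map fun x => vectorLabel (G (gridPoint M x))

/-- The number of alternating simplices, of both signs, of a map to `ℝᴺ`. -/
def fanParity [NeZero N] (M : ℕ) (G : (Fin i → ℝ) → Fin N → ℝ) : ZMod 2 :=
  gridSum M i fun l => fanCochain 0 (gridLabels M G l) + fanCochain 1 (gridLabels M G l)

/-- The grid with `M` steps is so fine that adjacent points never have antipodal labels. -/
def IsFine [NeZero N] (M : ℕ) (G : (Fin i → ℝ) → Fin N → ℝ) : Prop :=
  ∀ l : List (Fin i → ℕ), IsGridSimplex M l → ComplementaryFree (gridLabels M G l)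

theorem eventually_isFine [NeZero N] {G : (Fin i → ℝ) → Fin N → ℝ} (hG : Continuous G)
    (h0 : ∀ x, G x ≠ 0) : ∀ᶠ M in Filter.atTop, IsFine M G := by
  have hK : IsCompact (Metric.closedBall (0 : Fin i → ℝ) 1) := isCompact_closedBall _ _
  obtain ⟨x₀, -, hx₀⟩ := hK.exists_isMinOn ⟨0, by simp⟩ hG.norm.continuousOn
  set m := ‖G x₀‖
  have hm : 0 < m := norm_pos_iff.2 (h0 x₀)
  have hm' : ∀ x, ‖x‖ ≤ 1 → m ≤ ‖G x‖ := fun x hx => hx₀ (by simpa using hx)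
  obtain ⟨ε, hε, hu⟩ := Metric.uniformContinuousOn_iff.1
    (hK.uniformContinuousOn_of_continuous hG.continuousOn) m hm
  obtain ⟨M₀, hM₀⟩ := exists_nat_gt (2 / ε)
  filter_upwards [Filter.eventually_ge_atTop M₀, Filter.eventually_gt_atTop 0] with M hM hM1
  intro l hl a ha ha'
  obtain ⟨x, hx, rfl⟩ := List.mem_map.1 ha
  obtain ⟨y, hy, hxy⟩ := List.mem_map.1 ha'
  have hx1 := norm_gridPoint_le (hl.2.1 x hx)
  have hy1 := norm_gridPoint_le (hl.2.1 y hy)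
  refine lt_asymm (lt_dist_of_vectorLabel_eq_labelNeg hm (hm' _ hx1) (hm' _ hy1) hxy)
    (hu _ (by simpa using hx1) _ (by simpa using hy1) ?_)
  refine (dist_gridPoint_le hM1 (hl.2.2 x hx y hy) (hl.2.2 y hy x hx)).trans_lt ?_
  have hM' : (0 : ℝ) < M := by positivity
  have : (M₀ : ℝ) ≤ M := by exact_mod_cast hM
  rw [div_lt_iff₀ hM', ← div_lt_iff₀' hε]
  linarith

theorem fanParity_zero [NeZero N] (M : ℕ) (G : (Fin 0 → ℝ) → Fin N → ℝ) : fanParity M G = 1 := by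
  simp [fanParity, gridSum, gridLabels, fanCochain_of_pairwise, alternatesFrom, alternates]
  rw [add_comm, add_assoc, zmod_two_add_self, add_zero]

theorem fanParity_top [NeZero N] (M : ℕ) (G : (Fin N → ℝ) → Fin N → ℝ) : fanParity M G = 0 := by
  rw [fanParity, ← gridSum_zero (M := M) (i := N)]
  refine gridSum_congr fun l hl => ?_
  have : N < (gridLabels M G l).length := by rw [gridLabels, List.length_map, hl.1]; omega
  rw [fanCochain_eq_zero_of_length this, fanCochain_eq_zero_of_length this, add_zero]

/-- The inductive step of Ky Fan's theorem: if a map of the cube of dimension `i + 1` restricts to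
`G` on its top, to the antipode of `G` on its bottom, and is constant along the sides, then its
parity is that of `G`. -/
theorem fanParity_succ [NeZero N] {M : ℕ} (hM : 0 < M) {G : (Fin i → ℝ) → Fin N → ℝ}
    {G' : (Fin (i + 1) → ℝ) → Fin N → ℝ} (h0 : ∀ x, G x ≠ 0) (hG' : IsFine M G')
    (h_top : ∀ x, ‖x‖ ≤ 1 → G' (Fin.cons 1 x) = G x)
    (h_bot : ∀ x, ‖x‖ ≤ 1 → G' (Fin.cons (-1) x) = -G (-x))
    (h_side : ∀ x, ‖x‖ = 1 → ∀ s t, |s| ≤ 1 → |t| ≤ 1 → G' (Fin.cons s x) = G' (Fin.cons t x)) :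
    fanParity M G' = fanParity M G := by
  have hM0 : (M : ℝ) ≠ 0 := by positivity
  set φ : (Fin (i + 1) → ℕ) → Fin N × Bool := fun x => vectorLabel (G' (gridPoint M x)) with hφ
  set ψ : (Fin i → ℕ) → Fin N × Bool := fun x => vectorLabel (G (gridPoint M x)) with hψ
  have e1 : fanParity M G' = gridSum M (i + 1) (listCoboundary fun l => fanCochain 0 (l.map φ)) := by
    refine gridSum_congr fun l hl => ?_
    have := listCoboundary_fanCochain (hG' l hl)
    rw [listCoboundary_map, ← this]
    · rfl
    · rw [gridLabels, List.length_map, hl.1]; omega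
  have e_top : gridSum M i (fun l => fanCochain 0 ((l.map (Fin.cons M)).map φ)) =
      gridSum M i (fun l => fanCochain 0 (l.map ψ)) := by
    refine gridSum_congr fun l hl => ?_
    rw [List.map_map]
    congr 1
    refine List.map_congr_left fun x hx => ?_
    simp only [hφ, hψ, Function.comp]
    rw [gridPoint_cons, div_self hM0, show (2 : ℝ) * 1 - 1 = 1 by norm_num,
      h_top _ (norm_gridPoint_le (hl.2.1 x hx))]
  have e_bot : gridSum M i (fun l => fanCochain 0 ((l.map (Fin.cons 0)).map φ)) =
      gridSum M i (fun l => fanCochain 1 (l.map ψ)) := by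
    rw [← gridSum_reflect (fun l => fanCochain 1 (l.map ψ))]
    refine gridSum_congr fun l hl => ?_
    rw [fanCochain_perm 1 ((List.reverse_perm _).map ψ), ← fanCochain_map_labelNeg]
    simp only [List.map_map]
    congr 1
    refine List.map_congr_left fun x hx => ?_
    simp only [hφ, hψ, Function.comp]
    rw [gridPoint_cons, gridPoint_reflect hM (hl.2.1 x hx), ← vectorLabel_neg (h0 _),
      show 2 * (((0 : ℕ) : ℝ) / M) - 1 = -1 by simp, h_bot _ (norm_gridPoint_le (hl.2.1 x hx))]
  have e_side : ∀ s ∈ Finset.range M, gridSum M i (listCoboundary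
      (prismSum s fun l => fanCochain 0 (l.map φ))) = 0 := by
    intro s hs
    have hs' : (s : ℝ) + 1 ≤ M := by exact_mod_cast Finset.mem_range.1 hs
    have hM' : (0 : ℝ) < M := by positivity
    have hb : ∀ t : ℝ, 0 ≤ t → t ≤ M → |2 * (t / M) - 1| ≤ 1 := by
      intro t h h'
      have h1 : t / M ≤ 1 := div_le_one_of_le₀ h' hM'.le
      have h2 : 0 ≤ t / M := by positivity
      rw [abs_le]
      constructor <;> linarith
    refine gridSum_listCoboundary_eq_zero _ rfl fun l j hl hj => ?_
    refine prismSum_eq_zero_of_label_eq φ _ (fanCochain_duplicate 0) l fun x hx => ?_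
    have hx1 : ‖gridPoint M x‖ = 1 := by
      refine le_antisymm (norm_gridPoint_le (hl x hx)) ?_
      have hj1 : ‖gridPoint M x j‖ = 1 := by
        rcases hj with hj | hj
        · simp [gridPoint, hj x hx]
        · rw [gridPoint, hj x hx, div_self hM0]
          norm_num
      exact hj1 ▸ norm_le_pi_norm (gridPoint M x) j
    simp only [hφ]
    rw [gridPoint_cons, gridPoint_cons]
    refine congrArg _ (h_side _ hx1 _ _ (hb _ (by positivity) (by linarith)) (hb _ ?_ ?_))
    · positivity
    · push_cast
      exact hs'
  rw [e1, gridSum_listCoboundary, Finset.sum_eq_zero e_side, add_zero, e_top, e_bot, fanParity,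
    gridSum_add, add_comm]
  rfl

end Parity

/-! ### Maps into geometric realizations -/

section Realization

variable {V : Type*}

/-- The simplex of all weights of total weight one on a finite set `W` of vertices. -/
def weightSimplex (W : Finset V) : Set (V → ℝ) :=
  {a | (∀ v, 0 ≤ a v) ∧ (∀ v, a v ≠ 0 → v ∈ W) ∧ ∑ v ∈ W, a v = 1}

theorem convex_weightSimplex (W : Finset V) : Convex ℝ (weightSimplex W) := by
  rintro a ⟨ha, ha', ha''⟩ b ⟨hb, hb', hb''⟩ s t hs ht hst
  refine ⟨fun v => ?_, fun v hv => ?_, ?_⟩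
  · simp only [Pi.add_apply, Pi.smul_apply, smul_eq_mul]
    exact add_nonneg (mul_nonneg hs (ha v)) (mul_nonneg ht (hb v))
  · by_contra h
    apply hv
    have h1 : a v = 0 := by_contra fun h' => h (ha' v h')
    have h2 : b v = 0 := by_contra fun h' => h (hb' v h')
    simp [h1, h2]
  · simp only [Pi.add_apply, Pi.smul_apply, smul_eq_mul, Finset.sum_add_distrib, ← Finset.mul_sum]
    rw [ha'', hb'', mul_one, mul_one, hst]

theorem weightSimplex_mono {W W' : Finset V} (h : W ⊆ W') : weightSimplex W ⊆ weightSimplex W' := by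
  rintro a ⟨h1, h2, h3⟩
  refine ⟨h1, fun v hv => h (h2 v hv), ?_⟩
  rw [← h3]
  refine (Finset.sum_subset h fun v _ hv => ?_).symm
  by_contra h'
  exact hv (h2 v h')

theorem exists_pos_of_mem_weightSimplex {W : Finset V} {a : V → ℝ} (h : a ∈ weightSimplex W) :
    ∃ v, 0 < a v := by
  by_contra! h'
  have := h.2.2
  rw [Finset.sum_eq_zero fun v _ => le_antisymm (h' v) (h.1 v)] at this
  exact zero_ne_one this

theorem single_mem_weightSimplex [DecidableEq V] {W : Finset V} {v : V} (h : v ∈ W) :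
    (Pi.single v 1 : V → ℝ) ∈ weightSimplex W := by
  refine ⟨fun w => ?_, fun w hw => ?_, ?_⟩
  · by_cases e : w = v
    · subst e; simp
    · simp [e]
  · by_cases e : w = v
    · exact e ▸ h
    · simp [e] at hw
  · simp [Pi.single_apply, h]

variable {K : PreAbstractSimplicialComplex V}

theorem faces_subset {σ τ : Finset V} (hσ : σ ∈ K.faces) (h : τ ⊆ σ) (hτ : τ.Nonempty) :
    τ ∈ K.faces :=
  (K.isRelLowerSet_faces hσ).2 h hτ

namespace GeometricRealization

theorem mem_weightSimplex (p : GeometricRealization K) {W : Finset V} (h : p.1.support ⊆ W) :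
    (p.1 : V → ℝ) ∈ weightSimplex W := by
  refine weightSimplex_mono h ⟨p.2.1, fun v hv => Finsupp.mem_support_iff.2 hv, p.2.2.1⟩

/-- The point of the realization with given weights. -/
def ofWeights {W : Finset V} {a : V → ℝ} (ha : a ∈ weightSimplex W)
    (h : ∃ τ ∈ K.faces, ∀ v, a v ≠ 0 → v ∈ τ) : GeometricRealization K :=
  ⟨Finsupp.onFinset W a ha.2.1, ha.1, by
    rw [Finsupp.onFinset_sum _ (fun _ => rfl)]
    exact ha.2.2, by
    obtain ⟨τ, hτ, hτ'⟩ := h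
    refine faces_subset hτ (fun v hv => hτ' v (Finsupp.mem_support_iff.1 hv)) ?_
    obtain ⟨v, hv⟩ := exists_pos_of_mem_weightSimplex ha
    exact ⟨v, Finsupp.mem_support_iff.2 hv.ne'⟩⟩

@[ext]
theorem ext {p q : GeometricRealization K} (h : ∀ v, p.1 v = q.1 v) : p = q :=
  Subtype.ext (Finsupp.ext h)

theorem continuous_of_forall_closedSimplex {Y : Type*} [TopologicalSpace Y]
    {f : GeometricRealization K → Y}
    (h : ∀ σ ∈ K.faces, Continuous fun p : closedSimplex K σ => f p.1) : Continuous f := by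
  refine continuous_iSup_dom.2 fun σ => continuous_iSup_dom.2 fun hσ => ?_
  exact continuous_coinduced_dom.2 (h σ hσ)

theorem continuous_closedSimplex_apply (σ : Finset V) (v : V) :
    Continuous fun p : closedSimplex K σ => p.1.1 v :=
  (continuous_apply v).comp continuous_induced_dom

theorem continuous_apply (v : V) : Continuous fun p : GeometricRealization K => p.1 v :=
  continuous_of_forall_closedSimplex fun σ _ => continuous_closedSimplex_apply σ v

theorem continuous_coe : Continuous fun p : GeometricRealization K => (p.1 : V → ℝ) :=
  continuous_pi fun v => continuous_apply v

/-- Barycentric coordinates which are continuous and involve only finitely many vertices give a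
map which is continuous for the weak topology. -/
theorem continuous_ofWeights {X : Type*} [TopologicalSpace X] {W : Finset V} {a : X → V → ℝ}
    (hc : Continuous a) (ha : ∀ x, a x ∈ weightSimplex W)
    (h : ∀ x, ∃ τ ∈ K.faces, ∀ v, a x v ≠ 0 → v ∈ τ) :
    Continuous fun x => ofWeights (ha x) (h x) := by
  classical
  set S : {τ : Finset V // τ ∈ W.powerset.filter (· ∈ K.faces)} → Set X :=
    fun τ => {x | ∀ v, v ∉ τ.1 → a x v = 0}
  have hS : ∀ τ, IsClosed (S τ) := by
    intro τ
    simp only [S, Set.ofPred_forall]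
    exact isClosed_iInter fun v => isClosed_iInter fun _ =>
      isClosed_eq ((_root_.continuous_apply v).comp hc) continuous_const
  have hcov : ⋃ τ, S τ = Set.univ := by
    refine Set.eq_univ_of_forall fun x => Set.mem_iUnion.2 ?_
    refine ⟨⟨(ofWeights (ha x) (h x)).1.support, ?_⟩, fun v hv => ?_⟩
    · rw [Finset.mem_filter, Finset.mem_powerset]
      exact ⟨fun v hv => (ha x).2.1 v (Finsupp.mem_support_iff.1 hv), (ofWeights (ha x) (h x)).2.2.2⟩
    · exact Finsupp.notMem_support_iff.1 hv
  refine (locallyFinite_of_finite S).continuous hcov hS fun τ => ?_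
  rw [continuousOn_iff_continuous_domRestrict]
  have hτ := (Finset.mem_filter.1 τ.2).2
  set g : S τ → closedSimplex K τ.1 := fun x => ⟨ofWeights (ha x.1) (h x.1), fun v hv => by
    by_contra hv'
    exact Finsupp.mem_support_iff.1 hv (x.2 v hv')⟩
  have hg : Continuous g := continuous_induced_rng.2 (hc.comp continuous_subtype_val)
  have hval : Continuous fun p : closedSimplex K τ.1 => p.1 := by
    refine continuous_iSup_rng (i := τ.1) ?_
    refine continuous_iSup_rng (i := hτ) ?_
    exact continuous_coinduced_rng
  exact hval.comp hg

/-- The image of a compact space in a geometric realization involves only finitely many vertices.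
Otherwise a sum of barycentric coordinates with suitable coefficients, which is continuous for the
weak topology, would be unbounded on it. -/
theorem exists_support_subset {X : Type*} [TopologicalSpace X] [CompactSpace X]
    {F : X → GeometricRealization K} (hF : Continuous F) :
    ∃ W : Finset V, ∀ x, (F x).1.support ⊆ W := by
  classical
  set A : Set V := {v | ∃ x, (F x).1 v ≠ 0}
  by_cases hA : A.Finite
  · exact ⟨hA.toFinset, fun x v hv => hA.mem_toFinset.2 ⟨x, Finsupp.mem_support_iff.1 hv⟩⟩
  exfalso
  have hinf : Infinite A := Set.infinite_coe_iff.2 hA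
  set e := Infinite.natEmbedding A
  choose x hx using fun k => (e k).2
  have hx' : ∀ k, 0 < (F (x k)).1 (e k) := fun k => lt_of_le_of_ne ((F (x k)).2.1 _) (hx k).symm
  set c : V → ℝ := fun v => if h : ∃ k, (e k : V) = v then
    (h.choose : ℝ) / (F (x h.choose)).1 (e h.choose) else 0
  have hc : ∀ k, c (e k) = k / (F (x k)).1 (e k) := by
    intro k
    have h : ∃ k', (e k' : V) = e k := ⟨k, rfl⟩
    have h' : h.choose = k := e.injective (Subtype.ext h.choose_spec)
    simp only [c, dif_pos h]
    rw [h']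
  have hc0 : ∀ v, 0 ≤ c v := by
    intro v
    simp only [c]
    split_ifs with h
    · exact div_nonneg (Nat.cast_nonneg _) (hx' _).le
    · exact le_rfl
  have hΦ : Continuous fun p : GeometricRealization K => p.1.sum fun v a => c v * a := by
    refine continuous_of_forall_closedSimplex fun σ _ => ?_
    have e : (fun p : closedSimplex K σ => p.1.1.sum fun v a => c v * a) =
        fun p => ∑ v ∈ σ, c v * p.1.1 v :=
      funext fun p => Finsupp.sum_of_support_subset _ p.2 _ (by simp)
    rw [e]
    exact continuous_finsetSum _ fun v _ =>
      continuous_const.mul (continuous_closedSimplex_apply σ v)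
  obtain ⟨B, hB⟩ := (isCompact_range (hΦ.comp hF)).bddAbove
  obtain ⟨k, hk⟩ := exists_nat_gt B
  refine absurd (hB ⟨x k, rfl⟩) (not_le.2 (hk.trans_le ?_))
  have h1 : (k : ℝ) = c (e k) * (F (x k)).1 (e k) := by
    rw [hc, div_mul_cancel₀ _ (hx' k).ne']
  rw [h1]
  exact Finset.single_le_sum (f := fun v => c v * (F (x k)).1 v)
    (fun v _ => mul_nonneg (hc0 v) ((F (x k)).2.1 v)) (Finsupp.mem_support_iff.2 (hx k))

end GeometricRealization

end Realization

/-! ### Trivial homotopy groups and extensions of maps -/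

section Extension

open scoped unitInterval

/-- The affine identification of the unit cube with `[-1, 1]ⁱ`. -/
def cubeCenter {N : Type*} (x : N → I) : N → ℝ := fun j => 2 * (x j : ℝ) - 1

section Center

variable {N : Type*}

theorem continuous_cubeCenter : Continuous (cubeCenter (N := N)) := by
  unfold cubeCenter
  fun_prop

theorem cubeCenter_injective : Function.Injective (cubeCenter (N := N)) := by
  intro x y h
  funext j
  have := congrFun h j
  simp only [cubeCenter] at this
  exact Subtype.ext (by linarith)

variable [Fintype N]

theorem norm_cubeCenter_le (x : N → I) : ‖cubeCenter x‖ ≤ 1 := by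
  rw [pi_norm_le_iff_of_nonneg zero_le_one]
  intro j
  have h1 := (x j).2.1
  have h2 := (x j).2.2
  rw [Real.norm_eq_abs, abs_le, cubeCenter]
  constructor <;> linarith

theorem exists_cubeCenter_eq {z : N → ℝ} (hz : ‖z‖ ≤ 1) : ∃ x : N → I, cubeCenter x = z := by
  have h : ∀ j, |z j| ≤ 1 := fun j => (norm_le_pi_norm z j).trans hz
  refine ⟨fun j => ⟨(z j + 1) / 2, ?_, ?_⟩, ?_⟩
  · have := (abs_le.1 (h j)).1
    linarith
  · have := (abs_le.1 (h j)).2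
    linarith
  · funext j
    simp only [cubeCenter]
    ring

theorem norm_cubeCenter_eq_one_iff [Nonempty N] {x : N → I} :
    ‖cubeCenter x‖ = 1 ↔ x ∈ Cube.boundary N := by
  constructor
  · intro h
    obtain ⟨j, -, hj⟩ := Finset.exists_max_image Finset.univ (fun j => ‖cubeCenter x j‖)
      Finset.univ_nonempty
    have h1 : 1 ≤ ‖cubeCenter x j‖ := by
      rw [← h]
      exact (pi_norm_le_iff_of_nonneg (norm_nonneg _)).2 fun k => hj k (Finset.mem_univ k)
    refine ⟨j, ?_⟩
    rw [Real.norm_eq_abs, cubeCenter] at h1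
    have h2 := (x j).2.1
    have h3 := (x j).2.2
    rcases le_abs'.1 h1 with h | h
    · exact Or.inl (Subtype.ext (by simp only [Set.Icc.coe_zero]; linarith))
    · exact Or.inr (Subtype.ext (by simp only [Set.Icc.coe_one]; linarith))
  · rintro ⟨j, hj⟩
    refine le_antisymm (norm_cubeCenter_le x) ?_
    have h1 : ‖cubeCenter x j‖ = 1 := by
      rcases hj with hj | hj <;> simp [cubeCenter, hj]
      norm_num
    exact h1 ▸ norm_le_pi_norm (cubeCenter x) j

theorem norm_cubeCenter_of_mem_boundary {x : N → I} (hx : x ∈ Cube.boundary N) :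
    ‖cubeCenter x‖ = 1 := by
  have : Nonempty N := ⟨hx.choose⟩
  exact norm_cubeCenter_eq_one_iff.2 hx

end Center

section Wrap

variable {i : ℕ}

/-- The factor by which `wrapVector` scales a vector of norm `r`. -/
def wrapFactor (r : ℝ) : ℝ := 2 * min 1 ((1 - r) / max r (1 / 2))

theorem wrapFactor_mul (r : ℝ) : wrapFactor r * r = 1 - |1 - 2 * r| := by
  unfold wrapFactor
  rcases le_total r (1 / 2) with h | h
  · rw [max_eq_right h, min_eq_left (by rw [le_div_iff₀ (by norm_num)]; linarith),
      abs_of_nonneg (by linarith)]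
    ring
  · rw [max_eq_left h, min_eq_right (by rw [div_le_one (by linarith)]; linarith),
      abs_of_nonpos (by linarith)]
    field_simp
    ring

theorem wrapFactor_pos {r : ℝ} (h1 : r < 1) : 0 < wrapFactor r := by
  have : 0 < max r (1 / 2) := lt_max_of_lt_right (by norm_num)
  exact mul_pos two_pos (lt_min one_pos (div_pos (by linarith) this))

/-- A map of the cube `[-1, 1]ⁱ` to the boundary of a double cone which collapses the boundary of
the cube to the lower apex and is injective otherwise. -/
def wrapVector (z : Fin i → ℝ) : Fin (i + 1) → ℝ :=
  Fin.cons (1 - 2 * ‖z‖) (wrapFactor ‖z‖ • z)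

theorem continuous_wrapVector : Continuous (wrapVector (i := i)) := by
  have h : ∀ r : ℝ, max r (1 / 2) ≠ 0 := fun r => (lt_max_of_lt_right (by norm_num)).ne'
  have hf : Continuous wrapFactor := by
    unfold wrapFactor
    fun_prop (disch := exact h _)
  refine continuous_pi fun j => ?_
  refine Fin.cases ?_ (fun j => ?_) j
  · simp only [wrapVector, Fin.cons_zero]
    fun_prop
  · simp only [wrapVector, Fin.cons_succ, Pi.smul_apply, smul_eq_mul]
    have := hf.comp (continuous_norm (E := Fin i → ℝ))
    exact this.mul (continuous_apply j)

theorem abs_add_norm_wrapVector {z : Fin i → ℝ} (hz : ‖z‖ ≤ 1) :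
    |wrapVector z 0| + ‖Fin.tail (wrapVector z)‖ = 1 := by
  have h : 0 ≤ wrapFactor ‖z‖ := by
    rcases hz.lt_or_eq with h | h
    · exact (wrapFactor_pos h).le
    · simp [wrapFactor, h]
  simp only [wrapVector, Fin.cons_zero, Fin.tail_cons]
  rw [norm_smul, Real.norm_of_nonneg h, wrapFactor_mul]
  ring

theorem wrapVector_ne_zero {z : Fin i → ℝ} (hz : ‖z‖ ≤ 1) : wrapVector z ≠ 0 := by
  intro h
  have := abs_add_norm_wrapVector hz
  rw [h] at this
  have e : Fin.tail (0 : Fin (i + 1) → ℝ) = 0 := rfl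
  simp [e] at this

theorem eq_of_wrapVector_eq_smul {z z' : Fin i → ℝ} (hz : ‖z‖ ≤ 1) (hz' : ‖z'‖ ≤ 1) {c : ℝ}
    (hc : 0 < c) (h : wrapVector z = c • wrapVector z') : z = z' ∨ ‖z‖ = 1 ∧ ‖z'‖ = 1 := by
  have h1 := abs_add_norm_wrapVector hz
  have e : Fin.tail (c • wrapVector z') = c • Fin.tail (wrapVector z') := rfl
  rw [h, Pi.smul_apply, smul_eq_mul, abs_mul, abs_of_pos hc, e, norm_smul,
    Real.norm_of_nonneg hc.le, ← mul_add, abs_add_norm_wrapVector hz', mul_one] at h1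
  rw [h1, one_smul] at h
  have h2 := congrFun h 0
  have h3 := congrArg Fin.tail h
  simp only [wrapVector, Fin.cons_zero, Fin.tail_cons] at h2 h3
  have h4 : ‖z‖ = ‖z'‖ := by linarith
  rcases hz.lt_or_eq with h5 | h5
  · left
    rw [h4] at h3
    exact smul_right_injective _ (wrapFactor_pos (h4 ▸ h5)).ne' h3
  · exact Or.inr ⟨h5, h4 ▸ h5⟩

theorem exists_wrapVector_eq_smul (hi : 0 < i) {y : Fin (i + 1) → ℝ} (hy : y ≠ 0) :
    ∃ z : Fin i → ℝ, ‖z‖ ≤ 1 ∧ ∃ c : ℝ, 0 < c ∧ wrapVector z = c • y := by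
  set L := |y 0| + ‖Fin.tail y‖ with hL
  have hL0 : 0 < L := by
    by_contra h
    have h1 := abs_nonneg (y 0)
    have h2 := norm_nonneg (Fin.tail y)
    apply hy
    funext j
    refine Fin.cases ?_ (fun j => ?_) j
    · exact abs_eq_zero.1 (le_antisymm (by linarith) h1)
    · exact congrFun (norm_eq_zero.1 (le_antisymm (by linarith) h2)) j
  set s := L⁻¹ * y 0 with hs
  set p := L⁻¹ • Fin.tail y with hp
  have hsp : |s| + ‖p‖ = 1 := by
    rw [hs, hp, abs_mul, norm_smul, Real.norm_eq_abs, abs_of_pos (inv_pos.2 hL0), ← mul_add, ← hL,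
      inv_mul_cancel₀ hL0.ne']
  have hs1 : |s| ≤ 1 := by linarith [norm_nonneg p]
  have hy' : L⁻¹ • y = Fin.cons s p := by
    funext j
    refine Fin.cases ?_ (fun j => ?_) j <;> simp [hs, hp, Fin.tail]
  rcases hs1.lt_or_eq.imp_right (fun h => eq_or_eq_neg_of_abs_eq h) with h | h | h
  all_goals try
    have hs2 : -1 < s := by first | exact (abs_lt.1 h).1 | linarith
    set r := (1 - s) / 2 with hr
    have hr1 : r < 1 := by linarith
    have hc := wrapFactor_pos hr1
    have hz : ‖(wrapFactor r)⁻¹ • p‖ = r := by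
      rw [norm_smul, Real.norm_of_nonneg (inv_nonneg.2 hc.le)]
      have h1 := wrapFactor_mul r
      rw [show 1 - 2 * r = s by rw [hr]; ring] at h1
      rw [show ‖p‖ = wrapFactor r * r by linarith, inv_mul_cancel_left₀ hc.ne']
    refine ⟨(wrapFactor r)⁻¹ • p, by rw [hz]; exact hr1.le, L⁻¹, inv_pos.2 hL0, ?_⟩
    rw [hy', wrapVector, hz, smul_inv_smul₀ hc.ne', show 1 - 2 * r = s by rw [hr]; ring]
  have hp0 : p = 0 := norm_eq_zero.1 (by rw [h] at hsp; norm_num at hsp; simpa using hsp)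
  have : Nonempty (Fin i) := ⟨⟨0, hi⟩⟩
  refine ⟨fun _ => 1, by simp, L⁻¹, inv_pos.2 hL0, ?_⟩
  rw [hy', wrapVector, hp0, h]
  simp [wrapFactor]
  norm_num

theorem wrapVector_of_norm_eq_one {z : Fin i → ℝ} (hz : ‖z‖ = 1) :
    wrapVector z = Fin.cons (-1) 0 := by
  simp [wrapVector, hz, wrapFactor]
  norm_num

end Wrap

variable {Y : Type*} [TopologicalSpace Y]

/-- If `π_i(Y, y)` is trivial for all base points, then maps of the boundary of a cube of dimension
`i + 1` extend to the cube: the boundary is a cube of dimension `i` with its boundary collapsed. -/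
theorem exists_extension_of_subsingleton_homotopyGroup {i : ℕ}
    (h : ∀ y : Y, Subsingleton (π_ i Y y))
    (w : C(Metric.sphere (0 : Fin (i + 1) → ℝ) 1, Y)) :
    ∃ F : C(Metric.closedBall (0 : Fin (i + 1) → ℝ) 1, Y),
      ∀ x, F ⟨x.1, Metric.sphere_subset_closedBall x.2⟩ = w x := by
  rcases Nat.eq_zero_or_pos i with rfl | hi
  · have : Subsingleton (Fin (0 + 1)) := inferInstanceAs (Subsingleton (Fin 1))
    set p : Metric.sphere (0 : Fin 1 → ℝ) 1 := ⟨fun _ => -1, by simp⟩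
    set q : Metric.sphere (0 : Fin 1 → ℝ) 1 := ⟨fun _ => 1, by simp⟩
    have hj : Joined (w p) (w q) := by
      have hs : Subsingleton (ZerothHomotopy Y) :=
        (HomotopyGroup.pi0EquivZerothHomotopy (x := w p)).symm.subsingleton_congr.2 (h _)
      exact Quotient.exact (hs.elim (Quotient.mk _ (w p)) (Quotient.mk _ (w q)))
    obtain ⟨γ⟩ := hj
    refine ⟨⟨fun x => γ.extend ((x.1 0 + 1) / 2), ?_⟩, fun x => ?_⟩
    · exact γ.continuous_extend.comp
        ((((continuous_apply 0).comp continuous_subtype_val).add_const 1).div_const 2)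
    · have hx : ‖x.1 0‖ = 1 := by
        refine Eq.trans ?_ (mem_sphere_zero_iff_norm.1 x.2)
        rw [← pi_norm_const (ι := Fin (0 + 1)) (x.1 0)]
        exact congrArg _ (funext fun j => by rw [Subsingleton.elim j 0])
      rw [Real.norm_eq_abs] at hx
      rcases eq_or_eq_neg_of_abs_eq hx with hx | hx
      · have e : x = q := Subtype.ext (funext fun j => by rw [Subsingleton.elim j 0]; exact hx)
        simp [e]
        simp [q]
      · have e : x = p := Subtype.ext (funext fun j => by rw [Subsingleton.elim j 0]; exact hx)
        simp [e]
        simp [p]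
  have : Nonempty (Fin i) := ⟨⟨0, hi⟩⟩
  have hd : ∀ x : Fin i → I, 0 < ‖wrapVector (cubeCenter x)‖ := fun x =>
    norm_pos_iff.2 (wrapVector_ne_zero (norm_cubeCenter_le x))
  set q : (Fin i → I) → Metric.sphere (0 : Fin (i + 1) → ℝ) 1 := fun x =>
    ⟨‖wrapVector (cubeCenter x)‖⁻¹ • wrapVector (cubeCenter x), by
      rw [mem_sphere_zero_iff_norm, norm_smul, norm_inv, norm_norm, inv_mul_cancel₀ (hd x).ne']⟩
    with hq
  have hdc : Continuous fun x : Fin i → I => wrapVector (cubeCenter x) :=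
    continuous_wrapVector.comp continuous_cubeCenter
  have hqc : Continuous q :=
    Continuous.subtype_mk ((hdc.norm.inv₀ fun x => (hd x).ne').smul hdc) _
  have hq_eq : ∀ x x', q x = q x' → x = x' ∨ x ∈ Cube.boundary (Fin i) ∧
      x' ∈ Cube.boundary (Fin i) := by
    intro x x' hxx
    have h1 := congrArg (fun p => ‖wrapVector (cubeCenter x)‖ • p) (Subtype.ext_iff.1 hxx)
    simp only [hq] at h1
    rw [smul_inv_smul₀ (hd x).ne', smul_smul] at h1
    refine (eq_of_wrapVector_eq_smul (norm_cubeCenter_le x) (norm_cubeCenter_le x')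
      (mul_pos (hd x) (inv_pos.2 (hd x'))) h1).imp (fun h => cubeCenter_injective h) ?_
    rw [norm_cubeCenter_eq_one_iff, norm_cubeCenter_eq_one_iff]
    exact id
  have hq_surj : Function.Surjective q := by
    rintro ⟨y, hy⟩
    rw [mem_sphere_zero_iff_norm] at hy
    obtain ⟨z, hz, c, hc, hzc⟩ := exists_wrapVector_eq_smul hi
      (norm_ne_zero_iff.1 (by rw [hy]; exact one_ne_zero) : y ≠ 0)
    obtain ⟨x, rfl⟩ := exists_cubeCenter_eq hz
    refine ⟨x, Subtype.ext ?_⟩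
    simp only [hq, hzc]
    rw [norm_smul, hy, mul_one, Real.norm_of_nonneg hc.le, inv_smul_smul₀ hc.ne']
  obtain ⟨x₀, hx₀⟩ : ∃ x₀ : Fin i → I, x₀ ∈ Cube.boundary (Fin i) :=
    ⟨fun _ => 0, ⟨0, hi⟩, Or.inl rfl⟩
  have hqb : ∀ x ∈ Cube.boundary (Fin i), q x = q x₀ := by
    intro x hx
    refine Subtype.ext ?_
    simp only [hq]
    rw [wrapVector_of_norm_eq_one (norm_cubeCenter_eq_one_iff.2 hx),
      wrapVector_of_norm_eq_one (norm_cubeCenter_eq_one_iff.2 hx₀)]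
  set g : GenLoop (Fin i) Y (w (q x₀)) := ⟨w.comp ⟨q, hqc⟩, fun x hx => congrArg w (hqb x hx)⟩
  obtain ⟨H⟩ : GenLoop.Homotopic g GenLoop.const :=
    Quotient.exact ((h (w (q x₀))).elim (Quotient.mk _ g) (Quotient.mk _ GenLoop.const))
  have hHb : ∀ t, ∀ x ∈ Cube.boundary (Fin i), H (t, x) = w (q x₀) := fun t x hx =>
    (H.eq_fst t hx).trans (congrArg w (hqb x hx))
  -- The cone over `q` identifies the cylinder over the cube with a quotient of the ball.
  have hQ_mem : ∀ p : I × (Fin i → I),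
      (1 - (p.1 : ℝ)) • (q p.2).1 ∈ Metric.closedBall (0 : Fin (i + 1) → ℝ) 1 := by
    intro p
    rw [mem_closedBall_zero_iff, norm_smul, mem_sphere_zero_iff_norm.1 (q p.2).2, mul_one,
      Real.norm_of_nonneg (by linarith [p.1.2.2])]
    linarith [p.1.2.1]
  set Q : C(I × (Fin i → I), Metric.closedBall (0 : Fin (i + 1) → ℝ) 1) :=
    ⟨fun p => ⟨(1 - (p.1 : ℝ)) • (q p.2).1, hQ_mem p⟩, by
      refine Continuous.subtype_mk (Continuous.smul
        (continuous_const.sub (continuous_subtype_val.comp continuous_fst)) ?_) _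
      exact continuous_subtype_val.comp (hqc.comp continuous_snd)⟩ with hQ
  have hQ_norm : ∀ p, ‖(Q p).1‖ = 1 - (p.1 : ℝ) := by
    intro p
    simp only [hQ, ContinuousMap.coe_mk]
    rw [norm_smul, mem_sphere_zero_iff_norm.1 (q p.2).2, mul_one,
      Real.norm_of_nonneg (by linarith [p.1.2.2])]
  have hQ_surj : Function.Surjective Q := by
    rintro ⟨y, hy⟩
    rw [mem_closedBall_zero_iff] at hy
    by_cases hy0 : y = 0
    · exact ⟨(1, x₀), Subtype.ext (by simp [hQ, hy0])⟩
    · have hy1 : 0 < ‖y‖ := norm_pos_iff.2 hy0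
      obtain ⟨x, hx⟩ := hq_surj ⟨‖y‖⁻¹ • y, by
        rw [mem_sphere_zero_iff_norm, norm_smul, norm_inv, norm_norm, inv_mul_cancel₀ hy1.ne']⟩
      refine ⟨(⟨1 - ‖y‖, by linarith, by linarith⟩, x), Subtype.ext ?_⟩
      simp only [hQ, ContinuousMap.coe_mk, hx]
      rw [sub_sub_cancel, smul_inv_smul₀ hy1.ne']
  have hQ_quot : Topology.IsQuotientMap Q :=
    (Q.continuous.isClosedMap).isQuotientMap Q.continuous hQ_surj
  have hfac : ∀ p p', Q p = Q p' → H p = H p' := by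
    rintro ⟨t, x⟩ ⟨t', x'⟩ hpp
    have h1 := hQ_norm (t, x)
    rw [hpp, hQ_norm] at h1
    have ht : t' = t := Subtype.ext (by simpa using h1)
    subst ht
    by_cases ht : t' = 1
    · subst ht
      rw [H.apply_one, H.apply_one]
      rfl
    · have ht' : 1 - (t' : ℝ) ≠ 0 := fun h => ht (Subtype.ext (by simpa using (sub_eq_zero.1 h).symm))
      have h2 := smul_right_injective _ ht' (Subtype.ext_iff.1 hpp)
      rcases hq_eq x x' (Subtype.ext h2) with rfl | ⟨hx, hx'⟩
      · rfl
      · rw [hHb _ _ hx, hHb _ _ hx']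
  refine ⟨hQ_quot.lift H.toContinuousMap hfac, fun y => ?_⟩
  obtain ⟨x, rfl⟩ := hq_surj y
  have e : (⟨(q x).1, Metric.sphere_subset_closedBall (q x).2⟩ :
      Metric.closedBall (0 : Fin (i + 1) → ℝ) 1) = Q (0, x) := Subtype.ext (by simp [hQ])
  rw [e]
  have := DFunLike.congr_fun (hQ_quot.lift_comp H.toContinuousMap hfac) (0, x)
  exact this.trans (H.apply_zero x)

/-- A generalized loop is null-homotopic relative to the boundary as soon as it is homotopic to a
constant map through maps which are constant on the boundary. -/
theorem GenLoop.homotopic_const_of_homotopy {N : Type*} [Fintype N] {y : Y} (f : GenLoop N Y y)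
    (Φ : C(I × (N → I), Y)) (γ : C(I, Y)) (h₀ : ∀ x, Φ (0, x) = f x) (h₁ : ∀ x, Φ (1, x) = γ 1)
    (hb : ∀ t, ∀ x ∈ Cube.boundary N, Φ (t, x) = γ t) (hγ : γ 0 = y) :
    GenLoop.Homotopic f GenLoop.const := by
  -- `cl s` expands the cube by the factor `1 + s` and projects back to it.
  set cl : I → (N → I) → N → I := fun s x j =>
    Set.projIcc (0 : ℝ) 1 zero_le_one (1 / 2 + (1 + s) * (x j - 1 / 2)) with hcl
  have hcl_c : Continuous fun p : I × (N → I) => cl p.1 p.2 := by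
    refine continuous_pi fun j => continuous_projIcc.comp ?_
    fun_prop
  have hcl1 : Continuous fun x => cl 1 x :=
    hcl_c.comp (by fun_prop : Continuous fun x => ((1 : I), x))
  have hcl_zero : ∀ x, cl 0 x = x := by
    intro x
    funext j
    simp [hcl]
  have hcl_of_le : ∀ (s : I) x j, 1 / 2 ≤ (1 + (s : ℝ)) * |(x j : ℝ) - 1 / 2| →
      cl s x ∈ Cube.boundary N := by
    intro s x j h
    refine ⟨j, ?_⟩
    rcases le_total 0 ((x j : ℝ) - 1 / 2) with h' | h'
    · right
      rw [abs_of_nonneg h'] at h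
      exact Set.projIcc_of_right_le _ (by linarith)
    · left
      rw [abs_of_nonpos h'] at h
      exact Set.projIcc_of_le_left _ (by linarith)
  have hcl_b : ∀ s, ∀ x ∈ Cube.boundary N, cl s x ∈ Cube.boundary N := by
    rintro s x ⟨j, hj⟩
    refine hcl_of_le s x j ?_
    have h1 : |(x j : ℝ) - 1 / 2| = 1 / 2 := by
      rcases hj with hj | hj <;> rw [hj] <;> norm_num [abs_of_pos, abs_of_neg]
    rw [h1]
    linarith [s.2.1]
  set m : (N → I) → I := fun x => ⟨min 1 (2 - 2 * ‖cubeCenter x‖),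
    le_min zero_le_one (by linarith [norm_cubeCenter_le x]), min_le_left _ _⟩ with hm
  have hm_c : Continuous m := by
    refine Continuous.subtype_mk ?_ _
    have := (continuous_cubeCenter (N := N)).norm
    fun_prop
  have hm_b : ∀ x ∈ Cube.boundary N, m x = 0 := by
    intro x hx
    refine Subtype.ext ?_
    simp [hm, norm_cubeCenter_of_mem_boundary hx]
  have hm_γ : ∀ x, Φ (m x, cl 1 x) = γ (m x) := by
    intro x
    by_cases h : ∃ j, 1 / 2 ≤ ‖cubeCenter x j‖
    · obtain ⟨j, hj⟩ := h
      refine hb _ _ (hcl_of_le 1 x j ?_)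
      rw [Real.norm_eq_abs, cubeCenter, show 2 * (x j : ℝ) - 1 = 2 * (x j - 1 / 2) by ring, abs_mul,
        abs_of_pos two_pos] at hj
      simp only [Set.Icc.coe_one]
      linarith
    · push Not at h
      have h1 : ‖cubeCenter x‖ ≤ 1 / 2 :=
        (pi_norm_le_iff_of_nonneg (by norm_num)).2 fun j => (h j).le
      have h2 : m x = 1 := Subtype.ext (by
        simp only [hm, Set.Icc.coe_one]
        exact min_eq_left (by linarith))
      rw [h2, h₁]
  have s1 : f.1.HomotopicRel (Φ.comp ⟨fun x => ((0 : I), cl 1 x), by fun_prop⟩)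
      (Cube.boundary N) := by
    refine ⟨⟨⟨Φ.comp ⟨fun p => ((0 : I), cl p.1 p.2), by fun_prop⟩, ?_, ?_⟩, ?_⟩⟩
    · intro x
      simp [hcl_zero, h₀]
    · intro x
      rfl
    · intro t x hx
      change Φ (0, cl t x) = f x
      rw [h₀]
      exact (f.2 _ (hcl_b t x hx)).trans (f.2 x hx).symm
  have s2 : (Φ.comp ⟨fun x => ((0 : I), cl 1 x), by fun_prop⟩).HomotopicRel
      (γ.comp ⟨m, hm_c⟩) (Cube.boundary N) := by
    refine ⟨⟨⟨Φ.comp ⟨fun p => (p.1 * m p.2, cl 1 p.2), by fun_prop⟩, ?_, ?_⟩, ?_⟩⟩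
    · intro x
      simp
    · intro x
      simp [hm_γ]
    · intro t x hx
      simp [hm_b x hx]
  have s3 : (γ.comp ⟨m, hm_c⟩).HomotopicRel (GenLoop.const (N := N) (x := y)).1
      (Cube.boundary N) := by
    refine ⟨⟨⟨γ.comp ⟨fun p => σ p.1 * m p.2, by fun_prop⟩, ?_, ?_⟩, ?_⟩⟩
    · intro x
      simp
    · intro x
      simp [hγ]
    · intro t x hx
      simp [hm_b x hx]
  exact (s1.trans s2).trans s3

end Extension

/-! ### Partitions of unity of low order on cubes -/

section Kuhn

variable {m : ℕ}

/-- A function on `ℝᵐ` which is positive exactly at the points of the open star of the vertex `k` in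
the Kuhn triangulation of `ℝᵐ` with vertex set `ℤᵐ`. -/
def kuhnBump (k : Fin m → ℕ) (y : Fin m → ℝ) : ℝ :=
  (∏ j, max 0 (1 - |y j - k j|)) * ∏ j, ∏ l, max 0 (1 - |(y j - k j) - (y l - k l)|)

theorem continuous_kuhnBump (k : Fin m → ℕ) : Continuous (kuhnBump k) := by
  unfold kuhnBump
  fun_prop

theorem kuhnBump_nonneg (k : Fin m → ℕ) (y : Fin m → ℝ) : 0 ≤ kuhnBump k y :=
  mul_nonneg (Finset.prod_nonneg fun _ _ => le_max_left _ _)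
    (Finset.prod_nonneg fun _ _ => Finset.prod_nonneg fun _ _ => le_max_left _ _)

theorem kuhnBump_ne_zero_iff (k : Fin m → ℕ) (y : Fin m → ℝ) :
    kuhnBump k y ≠ 0 ↔
      (∀ j, |y j - k j| < 1) ∧ ∀ j l, |(y j - k j) - (y l - k l)| < 1 := by
  have h : ∀ a : ℝ, max 0 (1 - a) ≠ 0 ↔ a < 1 := by
    intro a
    rw [← sub_pos]
    constructor
    · intro h
      by_contra h'
      exact h (max_eq_left (not_lt.1 h'))
    · intro h
      exact (lt_max_of_lt_right h).ne'
  simp [kuhnBump, Finset.prod_ne_zero_iff, h]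

theorem kuhnBump_floor_pos {y : Fin m → ℝ} (hy : ∀ j, 0 ≤ y j) :
    0 < kuhnBump (fun j => ⌊y j⌋₊) y := by
  refine lt_of_le_of_ne (kuhnBump_nonneg _ _) (Ne.symm ((kuhnBump_ne_zero_iff _ _).2 ?_))
  have h1 := fun j => Nat.floor_le (hy j)
  have h2 := fun j => Nat.lt_floor_add_one (y j)
  refine ⟨fun j => ?_, fun j l => ?_⟩ <;> rw [abs_lt]
  · constructor <;> linarith [h1 j, h2 j]
  · constructor <;> linarith [h1 j, h2 j, h1 l, h2 l]

/-- The vertices of a simplex of the Kuhn triangulation are comparable. -/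
theorem le_or_le_of_kuhnBump_ne_zero {k k' : Fin m → ℕ} {y : Fin m → ℝ} (h : kuhnBump k y ≠ 0)
    (h' : kuhnBump k' y ≠ 0) : k ≤ k' ∨ k' ≤ k := by
  rw [kuhnBump_ne_zero_iff] at h h'
  by_contra! hcon
  obtain ⟨h1, h2⟩ := hcon
  rw [Pi.le_def, not_forall] at h1 h2
  obtain ⟨j, hj⟩ := h1
  obtain ⟨l, hl⟩ := h2
  have hj' : (k' j : ℝ) + 1 ≤ k j := by exact_mod_cast not_le.1 hj
  have hl' : (k l : ℝ) + 1 ≤ k' l := by exact_mod_cast not_le.1 hl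
  have h3 := abs_lt.1 (h.2 j l)
  have h4 := abs_lt.1 (h'.2 j l)
  linarith [h3.1, h4.2]

theorem le_add_one_of_kuhnBump_ne_zero {k k' : Fin m → ℕ} {y : Fin m → ℝ} (h : kuhnBump k y ≠ 0)
    (h' : kuhnBump k' y ≠ 0) (j : Fin m) : k j ≤ k' j + 1 := by
  have h1 := abs_lt.1 (((kuhnBump_ne_zero_iff _ _).1 h).1 j)
  have h2 := abs_lt.1 (((kuhnBump_ne_zero_iff _ _).1 h').1 j)
  have : (k j : ℝ) < k' j + 2 := by linarith [h1.1, h2.2]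
  have : k j < k' j + 2 := by exact_mod_cast this
  omega

theorem card_kuhnBump_ne_zero_le (S : Finset (Fin m → ℕ)) {y : Fin m → ℝ}
    (hS : ∀ k ∈ S, kuhnBump k y ≠ 0) : S.card ≤ m + 1 := by
  rcases S.eq_empty_or_nonempty with rfl | hne
  · simp
  obtain ⟨k₀, hk₀, hmin⟩ := S.exists_min_image (fun k => ∑ j, k j) hne
  have hsub : S.image (fun k => ∑ j, k j) ⊆ Finset.Icc (∑ j, k₀ j) (∑ j, k₀ j + m) := by
    intro n hn
    obtain ⟨k, hk, rfl⟩ := Finset.mem_image.1 hn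
    refine Finset.mem_Icc.2 ⟨hmin k hk, ?_⟩
    calc ∑ j, k j ≤ ∑ j, (k₀ j + 1) := Finset.sum_le_sum fun j _ =>
          le_add_one_of_kuhnBump_ne_zero (hS k hk) (hS k₀ hk₀) j
      _ = ∑ j, k₀ j + m := by simp [Finset.sum_add_distrib]
  have hinj : Set.InjOn (fun k : Fin m → ℕ => ∑ j, k j) S := by
    have key : ∀ k k' : Fin m → ℕ, k ≤ k' → ∑ j, k j = ∑ j, k' j → k = k' := by
      intro k k' hle heq
      have := (Finset.sum_eq_sum_iff_of_le fun j _ => hle j).1 heq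
      exact funext fun j => this j (Finset.mem_univ j)
    intro k hk k' hk' heq
    rcases le_or_le_of_kuhnBump_ne_zero (hS k hk) (hS k' hk') with h | h
    · exact key k k' h heq
    · exact (key k' k h heq.symm).symm
  calc S.card = (S.image fun k => ∑ j, k j).card := (Finset.card_image_of_injOn hinj).symm
    _ ≤ _ := Finset.card_le_card hsub
    _ = m + 1 := by rw [Nat.card_Icc]; omega

/-- The cube `[-1, 1]ᵐ` has finite partitions of unity of order `m + 1` with arbitrarily small
supports. -/
theorem exists_partition_of_unity (m : ℕ) {ε : ℝ} (hε : 0 < ε) :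
    ∃ (J : Finset (Fin m → ℝ)) (φ : (Fin m → ℝ) → (Fin m → ℝ) → ℝ),
      (∀ p ∈ J, ‖p‖ ≤ 1) ∧ (∀ p, ContinuousOn (φ p) (Metric.closedBall 0 1)) ∧
      (∀ p x, 0 ≤ φ p x) ∧ (∀ x, ‖x‖ ≤ 1 → ∑ p ∈ J, φ p x = 1) ∧
      (∀ p ∈ J, ∀ x, φ p x ≠ 0 → dist p x < ε) ∧
      ∀ x, ∀ S ⊆ J, (∀ p ∈ S, φ p x ≠ 0) → S.card ≤ m + 1 := by
  classical
  obtain ⟨M, hM⟩ := exists_nat_gt (2 / ε)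
  have hM0 : (0 : ℝ) < M := lt_trans (by positivity) hM
  have hM1 : 0 < M := by exact_mod_cast hM0
  set I : Finset (Fin m → ℕ) := Fintype.piFinset fun _ => Finset.range (M + 1) with hI
  have hinj : Function.Injective (gridPoint M : (Fin m → ℕ) → Fin m → ℝ) := by
    intro k k' h
    funext j
    have h1 := congrFun h j
    simp only [gridPoint] at h1
    have h2 : (k j : ℝ) / M = k' j / M := by linarith
    exact_mod_cast (div_left_inj' hM0.ne').1 h2
  -- `u` rescales the cube to `[0, M]ᵐ`.
  set u : (Fin m → ℝ) → Fin m → ℝ := fun x j => (x j + 1) / 2 * M with hu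
  have hu_c : Continuous u := by fun_prop
  set T : (Fin m → ℝ) → ℝ := fun x => ∑ k ∈ I, kuhnBump k (u x) with hT
  have hT_c : Continuous T := continuous_finsetSum _ fun k _ => (continuous_kuhnBump k).comp hu_c
  have hT_pos : ∀ x, ‖x‖ ≤ 1 → 0 < T x := by
    intro x hx
    have hx' : ∀ j, |x j| ≤ 1 := fun j => (norm_le_pi_norm x j).trans hx
    have h0 : ∀ j, 0 ≤ u x j := fun j => by
      have := (abs_le.1 (hx' j)).1
      have : 0 ≤ (x j + 1) / 2 := by linarith
      positivity
    refine (kuhnBump_floor_pos h0).trans_le (Finset.single_le_sum (f := fun k => kuhnBump k (u x))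
      (fun k _ => kuhnBump_nonneg _ _) ?_)
    rw [hI, Fintype.mem_piFinset]
    intro j
    rw [Finset.mem_range, Nat.lt_succ_iff]
    refine Nat.floor_le_of_le ?_
    have := (abs_le.1 (hx' j)).2
    exact mul_le_of_le_one_left hM0.le (by linarith)
  set κ : (Fin m → ℝ) → Fin m → ℕ := Function.invFun (gridPoint M)
  have hκ : ∀ k, κ (gridPoint M k) = k := Function.leftInverse_invFun hinj
  refine ⟨I.image (gridPoint M), fun p x => kuhnBump (κ p) (u x) / T x, ?_, ?_, ?_, ?_, ?_, ?_⟩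
  · intro p hp
    obtain ⟨k, hk, rfl⟩ := Finset.mem_image.1 hp
    rw [hI, Fintype.mem_piFinset] at hk
    exact norm_gridPoint_le fun j => Nat.lt_succ_iff.1 (Finset.mem_range.1 (hk j))
  · intro p
    refine ContinuousOn.div ((continuous_kuhnBump _).comp hu_c).continuousOn hT_c.continuousOn ?_
    exact fun x hx => (hT_pos x (by simpa using hx)).ne'
  · exact fun p x => div_nonneg (kuhnBump_nonneg _ _) (Finset.sum_nonneg fun _ _ =>
      kuhnBump_nonneg _ _)
  · intro x hx
    rw [Finset.sum_image hinj.injOn, ← Finset.sum_div]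
    simp only [hκ]
    exact div_self (hT_pos x hx).ne'
  · intro p hp x hpx
    obtain ⟨k, hk, rfl⟩ := Finset.mem_image.1 hp
    simp only [hκ] at hpx
    have h1 := ((kuhnBump_ne_zero_iff _ _).1 (div_ne_zero_iff.1 hpx).1).1
    refine (dist_pi_lt_iff hε).2 fun j => ?_
    have e : gridPoint M k j - x j = -(2 / M * (u x j - k j)) := by
      simp only [gridPoint, hu]
      field_simp
      ring
    rw [Real.dist_eq, e, abs_neg, abs_mul, abs_of_pos (by positivity)]
    have h2 : 2 / (M : ℝ) < ε := by
      rw [div_lt_iff₀ hM0]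
      rwa [div_lt_iff₀' hε] at hM
    refine lt_of_le_of_lt (mul_le_of_le_one_right (by positivity) (h1 j).le) h2
  · intro x S hS hS'
    have : S = (S.image κ).image (gridPoint M) := by
      rw [Finset.image_image]
      refine (Finset.image_congr fun p hp => ?_).trans Finset.image_id |>.symm
      obtain ⟨k, hk, rfl⟩ := Finset.mem_image.1 (hS hp)
      simp [hκ]
    rw [this]
    refine Finset.card_image_le.trans (card_kuhnBump_ne_zero_le _ (y := u x) fun k hk => ?_)
    obtain ⟨p, hp, rfl⟩ := Finset.mem_image.1 hk
    exact (div_ne_zero_iff.1 (hS' p hp)).1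

/-- Simplicial approximation: given continuous barycentric coordinates `a` on a cube, there is a
partition of unity of order `m + 1` and a choice of a vertex `s p` for each of its members such that
`s p` belongs to the support of `a` both on the support of the member and at the centres of all
members which meet it. -/
theorem exists_simplicial_approximation {m : ℕ} {V : Type*} {a : (Fin m → ℝ) → V → ℝ}
    (ha : Continuous a) (hpos : ∀ x, ∃ v, 0 < a x v) :
    ∃ (J : Finset (Fin m → ℝ)) (φ : (Fin m → ℝ) → (Fin m → ℝ) → ℝ) (s : (Fin m → ℝ) → V),
      (∀ p, ContinuousOn (φ p) (Metric.closedBall 0 1)) ∧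
      (∀ p x, 0 ≤ φ p x) ∧ (∀ x, ‖x‖ ≤ 1 → ∑ p ∈ J, φ p x = 1) ∧
      (∀ x, ∀ S ⊆ J, (∀ p ∈ S, φ p x ≠ 0) → S.card ≤ m + 1) ∧
      (∀ p ∈ J, ∀ x, ‖x‖ ≤ 1 → φ p x ≠ 0 → 0 < a x (s p)) ∧
      ∀ p ∈ J, ∀ q ∈ J, ∀ x, φ p x ≠ 0 → φ q x ≠ 0 → 0 < a q (s p) := by
  have hK : IsCompact (Metric.closedBall (0 : Fin m → ℝ) 1) := isCompact_closedBall _ _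
  obtain ⟨ε, hε, hL⟩ := lebesgue_number_lemma_of_metric hK (c := fun v : V => {x | 0 < a x v})
    (fun v => isOpen_lt continuous_const ((continuous_apply v).comp ha))
    (fun x _ => Set.mem_iUnion.2 (hpos x))
  obtain ⟨J, φ, hJ, hc, h0, h1, hd, hcard⟩ := exists_partition_of_unity m (half_pos hε)
  have : Nonempty V := ⟨(hpos 0).choose⟩
  have hs : ∀ p, ∃ v, ‖p‖ ≤ 1 → ∀ x, dist x p < ε → 0 < a x v := by
    intro p
    by_cases hp : ‖p‖ ≤ 1
    · obtain ⟨v, hv⟩ := hL p (by simpa using hp)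
      exact ⟨v, fun _ x hx => hv hx⟩
    · exact ⟨Classical.arbitrary V, fun h => absurd h hp⟩
  choose s hs using hs
  refine ⟨J, φ, s, hc, h0, h1, hcard, fun p hp x _ hpx => ?_, fun p hp q hq x hpx hqx => ?_⟩
  · refine hs p (hJ p hp) x ?_
    rw [dist_comm]
    linarith [hd p hp x hpx]
  · refine hs p (hJ p hp) q ?_
    have := dist_triangle q x p
    rw [dist_comm x p] at this
    linarith [hd p hp x hpx, hd q hq x hqx]

end Kuhn

/-! ### Lovász's bound for neighbourhood complexes -/

section Lovasz

variable {V : Type*} {R : V → V → Prop}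

/-- A family, parametrized by a space `X`, of pairs of points of the full simplex on the vertex set
such that every vertex in the support of the first point is adjacent to every vertex in the support
of the second point. Only finitely many vertices may occur in the whole family, so that continuity of
the coordinates suffices for continuity in the weak topology. -/
def IsEdgeMap {X : Type*} [TopologicalSpace X] (R : V → V → Prop) (u v : X → V → ℝ) : Prop :=
  Continuous u ∧ Continuous v ∧ (∃ W, ∀ x, u x ∈ weightSimplex W ∧ v x ∈ weightSimplex W) ∧
    ∀ x a b, u x a ≠ 0 → v x b ≠ 0 → R a b

theorem sum_single_mem_weightSimplex [DecidableEq V] {P : Type*} {J : Finset P} {f : P → ℝ}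
    {s : P → V} {W : Finset V} (h0 : ∀ p, 0 ≤ f p) (h1 : ∑ p ∈ J, f p = 1)
    (hs : ∀ p ∈ J, s p ∈ W) :
    ∑ p ∈ J, f p • (Pi.single (s p) 1 : V → ℝ) ∈ weightSimplex W :=
  (convex_weightSimplex W).sum_mem (fun p _ => h0 p) h1 fun p hp =>
    single_mem_weightSimplex (hs p hp)

theorem exists_of_sum_single_ne_zero [DecidableEq V] {P : Type*} {J : Finset P} {f : P → ℝ}
    {s : P → V} {v : V} (h : (∑ p ∈ J, f p • (Pi.single (s p) 1 : V → ℝ)) v ≠ 0) :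
    ∃ p ∈ J, f p ≠ 0 ∧ s p = v := by
  rw [Finset.sum_apply] at h
  obtain ⟨p, hp, hpv⟩ := Finset.exists_ne_zero_of_sum_ne_zero h
  simp only [Pi.smul_apply, smul_eq_mul] at hpv
  refine ⟨p, hp, left_ne_zero_of_mul hpv, ?_⟩
  by_contra hne
  exact right_ne_zero_of_mul hpv (Pi.single_eq_of_ne' hne 1)

theorem continuous_sum_single [DecidableEq V] {X P : Type*} [TopologicalSpace X] {J : Finset P}
    {f : P → X → ℝ} (s : P → V) (hf : ∀ p, Continuous (f p)) :
    Continuous fun x => ∑ p ∈ J, f p x • (Pi.single (s p) 1 : V → ℝ) :=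
  continuous_finsetSum _ fun p _ => (hf p).smul continuous_const

theorem norm_inv_max_smul {E : Type*} [NormedAddCommGroup E] [NormedSpace ℝ E] {c : ℝ} (hc : 0 < c)
    (x : E) : ‖(max ‖x‖ c)⁻¹ • x‖ = ‖x‖ / max ‖x‖ c := by
  have : 0 < max ‖x‖ c := lt_max_of_lt_right hc
  rw [norm_smul, norm_inv, Real.norm_of_nonneg this.le, inv_mul_eq_div]

theorem norm_inv_max_smul_le {E : Type*} [NormedAddCommGroup E] [NormedSpace ℝ E] {c : ℝ}
    (hc : 0 < c) (x : E) : ‖(max ‖x‖ c)⁻¹ • x‖ ≤ 1 := by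
  rw [norm_inv_max_smul hc]
  exact div_le_one_of_le₀ (le_max_left _ _) (hc.le.trans (le_max_right _ _))

theorem continuous_inv_max_smul {E : Type*} [NormedAddCommGroup E] [NormedSpace ℝ E] {c : ℝ}
    (hc : 0 < c) : Continuous fun x : E => (max ‖x‖ c)⁻¹ • x := by
  have : ∀ x : E, max ‖x‖ c ≠ 0 := fun x => (lt_max_of_lt_right hc).ne'
  fun_prop (disch := exact this _)

variable {K : PreAbstractSimplicialComplex V}

/-- The first component of an edge map on the boundary of a cube extends to the cube. -/
theorem IsEdgeMap.exists_filling
    (hK : ∀ σ, σ ∈ K.faces ↔ σ.Nonempty ∧ ∃ z, ∀ x ∈ σ, R x z) {i : ℕ}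
    (hπ : ∀ y : GeometricRealization K, Subsingleton (π_ i (GeometricRealization K) y))
    {u v : Metric.sphere (0 : Fin (i + 1) → ℝ) 1 → V → ℝ} (huv : IsEdgeMap R u v) :
    ∃ h : (Fin (i + 1) → ℝ) → V → ℝ, Continuous h ∧ (∃ W, ∀ x, h x ∈ weightSimplex W) ∧
      (∀ x, ∃ z, ∀ a, h x a ≠ 0 → R a z) ∧
      ∀ x : Metric.sphere (0 : Fin (i + 1) → ℝ) 1, h x = u x := by
  classical
  obtain ⟨hu, hv, ⟨W₀, hW₀⟩, hR⟩ := huv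
  have hface : ∀ x, ∃ τ ∈ K.faces, ∀ a, u x a ≠ 0 → a ∈ τ := by
    intro x
    obtain ⟨b, hb⟩ := exists_pos_of_mem_weightSimplex (hW₀ x).2
    obtain ⟨a, ha⟩ := exists_pos_of_mem_weightSimplex (hW₀ x).1
    refine ⟨W₀.filter fun a => u x a ≠ 0, (hK _).2 ⟨⟨a, ?_⟩, b, fun a ha => ?_⟩, fun a ha => ?_⟩
    · exact Finset.mem_filter.2 ⟨(hW₀ x).1.2.1 a ha.ne', ha.ne'⟩
    · exact hR x a b (Finset.mem_filter.1 ha).2 hb.ne'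
    · exact Finset.mem_filter.2 ⟨(hW₀ x).1.2.1 a ha, ha⟩
  obtain ⟨F, hF⟩ := exists_extension_of_subsingleton_homotopyGroup hπ
    ⟨fun x => GeometricRealization.ofWeights (hW₀ x).1 (hface x),
      GeometricRealization.continuous_ofWeights hu (fun x => (hW₀ x).1) hface⟩
  obtain ⟨W₁, hW₁⟩ := GeometricRealization.exists_support_subset F.continuous
  have hr : ∀ x : Fin (i + 1) → ℝ, (max ‖x‖ 1)⁻¹ • x ∈ Metric.closedBall 0 1 := fun x =>
    mem_closedBall_zero_iff.2 (norm_inv_max_smul_le one_pos x)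
  refine ⟨fun x => (F ⟨(max ‖x‖ 1)⁻¹ • x, hr x⟩).1, ?_, ⟨W₁, fun x => ?_⟩, fun x => ?_, fun x => ?_⟩
  · exact GeometricRealization.continuous_coe.comp
      (F.continuous.comp (Continuous.subtype_mk (continuous_inv_max_smul one_pos) _))
  · exact GeometricRealization.mem_weightSimplex _ (hW₁ _)
  · obtain ⟨-, z, hz⟩ := (hK _).1 (F ⟨(max ‖x‖ 1)⁻¹ • x, hr x⟩).2.2.2
    exact ⟨z, fun a ha => hz a (Finsupp.mem_support_iff.2 ha)⟩
  · have e : (⟨(max ‖x.1‖ 1)⁻¹ • x.1, hr x.1⟩ : Metric.closedBall (0 : Fin (i + 1) → ℝ) 1) =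
        ⟨x.1, Metric.sphere_subset_closedBall x.2⟩ := by
      refine Subtype.ext ?_
      simp [mem_sphere_zero_iff_norm.1 x.2]
    beta_reduce
    rw [e, hF]
    rfl

/-- A family of points of the neighbourhood complex which is parametrized by a cube can be
approximated within the supports by the first component of an edge map. -/
theorem exists_isEdgeMap_approximation {m : ℕ} {h : (Fin m → ℝ) → V → ℝ} (hc : Continuous h)
    (hpos : ∀ x, ∃ v, 0 < h x v) (hnb : ∀ x, ∃ z, ∀ a, h x a ≠ 0 → R a z)
    {p : (Fin m → ℝ) → Fin m → ℝ} (hp_c : Continuous p) (hp1 : ∀ x, ‖p x‖ ≤ 1) :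
    ∃ u v : (Fin m → ℝ) → V → ℝ, IsEdgeMap R u v ∧ ∀ x a, u x a ≠ 0 → h (p x) a ≠ 0 := by
  classical
  obtain ⟨J, φ, s, hφc, hφ0, hφ1, -, hs, hst⟩ := exists_simplicial_approximation hc hpos
  choose t ht using hnb
  have hφp : ∀ q, Continuous fun x => φ q (p x) := fun q =>
    (hφc q).comp_continuous hp_c fun x => mem_closedBall_zero_iff.2 (hp1 x)
  refine ⟨fun x => ∑ q ∈ J, φ q (p x) • (Pi.single (s q) 1 : V → ℝ),
    fun x => ∑ q ∈ J, φ q (p x) • (Pi.single (t q) 1 : V → ℝ),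
    ⟨continuous_sum_single s hφp, continuous_sum_single t hφp,
      ⟨J.image s ∪ J.image t, fun x => ⟨?_, ?_⟩⟩, fun x a b ha hb => ?_⟩, fun x a ha => ?_⟩
  · exact sum_single_mem_weightSimplex (fun q => hφ0 q _) (hφ1 _ (hp1 x)) fun q hq =>
      Finset.mem_union_left _ (Finset.mem_image_of_mem s hq)
  · exact sum_single_mem_weightSimplex (fun q => hφ0 q _) (hφ1 _ (hp1 x)) fun q hq =>
      Finset.mem_union_right _ (Finset.mem_image_of_mem t hq)
  · obtain ⟨q, hq, hqx, rfl⟩ := exists_of_sum_single_ne_zero ha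
    obtain ⟨q', hq', hqx', rfl⟩ := exists_of_sum_single_ne_zero hb
    exact ht q' _ (hst q hq q' hq' _ hqx hqx').ne'
  · obtain ⟨q, hq, hqx, rfl⟩ := exists_of_sum_single_ne_zero ha
    exact (hs q hq _ (hp1 x) hqx).ne'

/-- If the neighbourhood complex has trivial `π_i`, then edge maps on the boundary of the cube of
dimension `i + 1` extend to the cube. In the inner half of the cube, the extension is a simplicial
approximation of a filling of the first component, together with a choice of common neighbours; near
the boundary, first the second and then the first component is deformed to the given one. -/
theorem IsEdgeMap.exists_extension
    (hK : ∀ σ, σ ∈ K.faces ↔ σ.Nonempty ∧ ∃ z, ∀ x ∈ σ, R x z) {i : ℕ}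
    (hπ : ∀ y : GeometricRealization K, Subsingleton (π_ i (GeometricRealization K) y))
    {u v : Metric.sphere (0 : Fin (i + 1) → ℝ) 1 → V → ℝ} (huv : IsEdgeMap R u v) :
    ∃ u' v' : (Fin (i + 1) → ℝ) → V → ℝ, IsEdgeMap R u' v' ∧
      ∀ x : Metric.sphere (0 : Fin (i + 1) → ℝ) 1, u' x = u x ∧ v' x = v x := by
  classical
  obtain ⟨h, hh_c, ⟨W₁, hh_W⟩, hh_nb, hh_u⟩ := huv.exists_filling hK hπ
  obtain ⟨-, hv, ⟨W₀, hW₀⟩, hR⟩ := huv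
  obtain ⟨g, hg⟩ := ContinuousMap.exists_restrict_eq (Metric.isClosed_sphere (x := 0) (ε := 1))
    (⟨v, hv⟩ : C(Metric.sphere (0 : Fin (i + 1) → ℝ) 1, V → ℝ))
  have hg' : ∀ x : Metric.sphere (0 : Fin (i + 1) → ℝ) 1, g x = v x := fun x =>
    DFunLike.congr_fun hg x
  -- `p` expands the inner half of the cube to the cube and maps the rest radially to its boundary.
  obtain ⟨p, hp⟩ : ∃ p : (Fin (i + 1) → ℝ) → Fin (i + 1) → ℝ,
      p = fun x => (max ‖x‖ (1 / 2))⁻¹ • x := ⟨_, rfl⟩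
  have hp_c : Continuous p := hp ▸ continuous_inv_max_smul (by norm_num)
  have hp1 : ∀ x, ‖p x‖ ≤ 1 := hp ▸ norm_inv_max_smul_le (by norm_num)
  have hp_sphere : ∀ x, 1 / 2 < ‖x‖ → p x ∈ Metric.sphere (0 : Fin (i + 1) → ℝ) 1 := by
    intro x hx
    rw [mem_sphere_zero_iff_norm, hp, norm_inv_max_smul (by norm_num), max_eq_left hx.le,
      div_self (by linarith)]
  obtain ⟨u₁, v₁, ⟨hu₁_c, hv₁_c, ⟨W₂, hW₂⟩, huv₁⟩, hu₁_h⟩ := exists_isEdgeMap_approximation hh_c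
    (fun x => exists_pos_of_mem_weightSimplex (hh_W x)) hh_nb hp_c hp1
  obtain ⟨W, hW₀W, hW₁W, hW₂W⟩ : ∃ W, W₀ ⊆ W ∧ W₁ ⊆ W ∧ W₂ ⊆ W :=
    ⟨W₀ ∪ (W₁ ∪ W₂), by simp, fun a ha => by simp [ha], fun a ha => by simp [ha]⟩
  have hu₁_W : ∀ x, u₁ x ∈ weightSimplex W := fun x => weightSimplex_mono hW₂W (hW₂ x).1
  have hv₁_W : ∀ x, v₁ x ∈ weightSimplex W := fun x => weightSimplex_mono hW₂W (hW₂ x).2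
  -- `α` and `β` are the cut-off functions for the second and the first component; `β` vanishes
  -- where `α < 1`, so that the filling never meets the approximate second component.
  set α : (Fin (i + 1) → ℝ) → ℝ := fun x => max 0 (min 1 (4 * ‖x‖ - 2)) with hα
  set β : (Fin (i + 1) → ℝ) → ℝ := fun x => max 0 (min 1 (4 * ‖x‖ - 3)) with hβ
  have hα_c : Continuous α := by fun_prop
  have hβ_c : Continuous β := by fun_prop
  have hα01 : ∀ x, 0 ≤ α x ∧ α x ≤ 1 := fun x =>
    ⟨le_max_left _ _, max_le zero_le_one (min_le_left _ _)⟩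
  have hβ01 : ∀ x, 0 ≤ β x ∧ β x ≤ 1 := fun x =>
    ⟨le_max_left _ _, max_le zero_le_one (min_le_left _ _)⟩
  have hα0 : ∀ x, α x ≠ 0 → 1 / 2 < ‖x‖ := by
    intro x hx
    by_contra hx'
    exact hx (max_eq_left (min_le_of_right_le (by linarith)))
  have hβ0 : ∀ x, β x ≠ 0 → 3 / 4 < ‖x‖ := by
    intro x hx
    by_contra hx'
    exact hx (max_eq_left (min_le_of_right_le (by linarith)))
  have hα1 : ∀ x, 3 / 4 ≤ ‖x‖ → α x = 1 := by
    intro x hx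
    simp only [hα]
    rw [min_eq_left (by linarith), max_eq_right zero_le_one]
  have hgp : ∀ x, α x ≠ 0 → ∃ y : Metric.sphere (0 : Fin (i + 1) → ℝ) 1,
      g (p x) = v y ∧ h (p x) = u y := fun x hx =>
    ⟨⟨p x, hp_sphere x (hα0 x hx)⟩, hg' ⟨p x, hp_sphere x (hα0 x hx)⟩,
      hh_u ⟨p x, hp_sphere x (hα0 x hx)⟩⟩
  refine ⟨fun x => (1 - β x) • u₁ x + β x • h (p x), fun x => (1 - α x) • v₁ x + α x • g (p x),
    ⟨?_, ?_, ⟨W, fun x => ⟨?_, ?_⟩⟩, ?_⟩, ?_⟩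
  · exact ((continuous_const.sub hβ_c).smul hu₁_c).add
      (hβ_c.smul (hh_c.comp hp_c))
  · exact ((continuous_const.sub hα_c).smul hv₁_c).add
      (hα_c.smul (g.continuous.comp hp_c))
  · exact convex_weightSimplex W (hu₁_W x) (weightSimplex_mono hW₁W (hh_W _))
      (by linarith [hβ01 x]) (hβ01 x).1 (by ring)
  · beta_reduce
    by_cases hx : α x = 0
    · simpa [hx] using hv₁_W x
    · obtain ⟨y, hy, -⟩ := hgp x hx
      rw [hy]
      exact convex_weightSimplex W (hv₁_W x) (weightSimplex_mono hW₀W (hW₀ y).2)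
        (by linarith [hα01 x]) (hα01 x).1 (by ring)
  · intro x a b ha hb
    simp only [Pi.add_apply, Pi.smul_apply, smul_eq_mul] at ha hb
    have ha' : u₁ x a ≠ 0 ∨ β x ≠ 0 ∧ h (p x) a ≠ 0 := by
      by_contra! hcon
      apply ha
      rw [hcon.1]
      by_cases hβx : β x = 0
      · simp [hβx]
      · simp [hcon.2 hβx]
    have hb' : (1 - α x ≠ 0 ∧ v₁ x b ≠ 0) ∨ (α x ≠ 0 ∧ g (p x) b ≠ 0) := by
      by_contra! hcon
      apply hb
      have h1 : (1 - α x) * v₁ x b = 0 := by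
        by_cases hx : 1 - α x = 0
        · rw [hx, zero_mul]
        · rw [hcon.1 hx, mul_zero]
      have h2 : α x * g (p x) b = 0 := by
        by_cases hx : α x = 0
        · rw [hx, zero_mul]
        · rw [hcon.2 hx, mul_zero]
      rw [h1, h2, add_zero]
    rcases hb' with ⟨hαx, hb'⟩ | ⟨hαx, hb'⟩
    · rcases ha' with ha' | ⟨hβx, -⟩
      · exact huv₁ x a b ha' hb'
      · exact absurd (by rw [hα1 x (hβ0 x hβx).le, sub_self]) hαx
    · obtain ⟨y, hy, hy'⟩ := hgp x hαx
      rw [hy] at hb'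
      refine hR y a b ?_ hb'
      rw [← hy']
      exact ha'.elim (hu₁_h x a) fun h => h.2
  · intro x
    have hx := mem_sphere_zero_iff_norm.1 x.2
    have h1 : α x = 1 := hα1 _ (by rw [hx]; norm_num)
    have h2 : β x = 1 := by
      simp only [hβ, hx]
      norm_num
    have h3 : p x = x := by
      simp only [hp, hx]
      norm_num
    simp only [h1, h2, h3, sub_self, zero_smul, zero_add, one_smul]
    exact ⟨hh_u x, hg' x⟩

variable {N : ℕ}

/-- The difference of the colour distributions of two points of the full simplex. -/
def colorDifference (c : V → Fin N) (a b : V → ℝ) (j : Fin N) : ℝ :=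
  open Classical in ∑ᶠ w, if c w = j then a w - b w else 0

theorem colorDifference_eq_sum (c : V → Fin N) {a b : V → ℝ} {W : Finset V}
    (ha : a ∈ weightSimplex W) (hb : b ∈ weightSimplex W) (j : Fin N) :
    colorDifference c a b j = ∑ w ∈ W, if c w = j then a w - b w else 0 := by
  classical
  have hsupp : (Function.support fun w => if c w = j then a w - b w else 0) ⊆ (W : Set V) := by
    intro w hw
    by_contra hw'
    have h1 : a w = 0 := by_contra fun h => hw' (ha.2.1 w h)
    have h2 : b w = 0 := by_contra fun h => hw' (hb.2.1 w h)
    simp [h1, h2] at hw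
  rw [← finsum_eq_sum_of_support_subset _ hsupp, colorDifference]

theorem colorDifference_swap (c : V → Fin N) (a b : V → ℝ) :
    colorDifference c b a = -colorDifference c a b := by
  classical
  funext j
  rw [Pi.neg_apply, colorDifference, colorDifference, ← finsum_neg_distrib]
  refine finsum_congr fun w => ?_
  split_ifs <;> simp

theorem IsEdgeMap.continuous_colorDifference {X : Type*} [TopologicalSpace X] {u v : X → V → ℝ}
    (h : IsEdgeMap R u v) (c : V → Fin N) : Continuous fun x => colorDifference c (u x) (v x) := by
  obtain ⟨hu, hv, ⟨W, hW⟩, -⟩ := h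
  refine continuous_pi fun j => ?_
  simp_rw [fun x => colorDifference_eq_sum c (hW x).1 (hW x).2 j]
  refine continuous_finsetSum _ fun w _ => ?_
  split_ifs
  · exact ((continuous_apply w).comp hu).sub ((continuous_apply w).comp hv)
  · exact continuous_const

/-- For a proper colouring, the two points of an edge have different colour distributions. -/
theorem IsEdgeMap.colorDifference_ne_zero {X : Type*} [TopologicalSpace X] {u v : X → V → ℝ}
    (h : IsEdgeMap R u v) {c : V → Fin N} (hc : ∀ a b, R a b → c a ≠ c b) (x : X) :
    colorDifference c (u x) (v x) ≠ 0 := by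
  obtain ⟨hu, hv, ⟨W, hW⟩, hR⟩ := h
  obtain ⟨a, ha⟩ := exists_pos_of_mem_weightSimplex (hW x).1
  have h0 : ∀ w, c w = c a → v x w = 0 := by
    intro w hw
    by_contra hne
    exact hc a w (hR x a w ha.ne' hne) hw.symm
  have hpos : 0 < colorDifference c (u x) (v x) (c a) := by
    rw [colorDifference_eq_sum c (hW x).1 (hW x).2]
    refine Finset.sum_pos' (fun w _ => ?_) ⟨a, (hW x).1.2.1 a ha.ne', ?_⟩
    · split_ifs with hw
      · rw [h0 w hw, sub_zero]
        exact (hW x).1.1 w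
      · exact le_rfl
    · rw [if_pos rfl, h0 a rfl, sub_zero]
      exact ha
  intro hzero
  rw [hzero] at hpos
  exact lt_irrefl _ hpos

theorem norm_finCons {i : ℕ} (s : ℝ) (x : Fin i → ℝ) :
    ‖(Fin.cons s x : Fin (i + 1) → ℝ)‖ = max |s| ‖x‖ := by
  refine le_antisymm ?_ (max_le ?_ ?_)
  · refine (pi_norm_le_iff_of_nonneg (le_max_of_le_left (abs_nonneg _))).2 fun j => ?_
    refine Fin.cases ?_ (fun j => ?_) j
    · exact le_max_left _ _
    · exact (norm_le_pi_norm x j).trans (le_max_right _ _)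
  · exact norm_le_pi_norm (Fin.cons s x : Fin (i + 1) → ℝ) 0
  · exact (pi_norm_le_iff_of_nonneg (norm_nonneg _)).2 fun j =>
      norm_le_pi_norm (Fin.cons s x : Fin (i + 1) → ℝ) j.succ

/-- An edge map on a cube whose components are interchanged by the antipodal map of the boundary
gives an edge map on the boundary of the next cube, equal to the given one over the upper hemisphere
and to its antipode over the lower hemisphere. -/
theorem IsEdgeMap.double (hR : ∀ a b, R a b → R b a) {i : ℕ} {u v : (Fin i → ℝ) → V → ℝ}
    (h : IsEdgeMap R u v) (hanti : ∀ x, ‖x‖ = 1 → v x = u (-x)) :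
    IsEdgeMap R
      (fun x : Metric.sphere (0 : Fin (i + 1) → ℝ) 1 =>
        if 0 ≤ x.1 0 then u (Fin.tail x.1) else v (-Fin.tail x.1))
      (fun x : Metric.sphere (0 : Fin (i + 1) → ℝ) 1 =>
        if 0 ≤ x.1 0 then v (Fin.tail x.1) else u (-Fin.tail x.1)) := by
  obtain ⟨hu, hv, ⟨W, hW⟩, huv⟩ := h
  have hn : ∀ x : Metric.sphere (0 : Fin (i + 1) → ℝ) 1, 0 = x.1 0 → ‖Fin.tail x.1‖ = 1 := by
    intro x hx
    have h1 := mem_sphere_zero_iff_norm.1 x.2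
    rw [← Fin.cons_self_tail x.1, norm_finCons, ← hx, abs_zero,
      max_eq_right (norm_nonneg _)] at h1
    exact h1
  have ht : Continuous fun x : Metric.sphere (0 : Fin (i + 1) → ℝ) 1 => Fin.tail x.1 :=
    continuous_pi fun j => (continuous_apply j.succ).comp continuous_subtype_val
  have h0 : Continuous fun x : Metric.sphere (0 : Fin (i + 1) → ℝ) 1 => x.1 0 :=
    (continuous_apply 0).comp continuous_subtype_val
  refine ⟨?_, ?_, ⟨W, fun x => ?_⟩, fun x a b => ?_⟩
  · refine (hu.comp ht).if_le (hv.comp ht.neg) continuous_const h0 fun x hx => ?_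
    simp only [Function.comp]
    rw [hanti _ (by rw [norm_neg, hn x hx]), neg_neg]
  · refine (hv.comp ht).if_le (hu.comp ht.neg) continuous_const h0 fun x hx => ?_
    exact hanti _ (hn x hx)
  · beta_reduce
    split_ifs
    · exact hW _
    · exact (hW _).symm
  · beta_reduce
    split_ifs
    · exact huv _ a b
    · exact fun ha hb => hR _ _ (huv _ b a hb ha)

/-- Lovász's theorem: the neighbourhood complex of a graph which has a proper colouring with `N`
colours and an edge is not `(N - 1)`-connected. -/
theorem not_forall_subsingleton_homotopyGroup_of_coloring [NeZero N]
    (hR : ∀ a b, R a b → R b a) {c : V → Fin N} (hc : ∀ a b, R a b → c a ≠ c b)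
    (hK : ∀ σ, σ ∈ K.faces ↔ σ.Nonempty ∧ ∃ z, ∀ x ∈ σ, R x z) {a₀ b₀ : V} (h₀ : R a₀ b₀) :
    ¬ ∀ i < N, ∀ y : GeometricRealization K, Subsingleton (π_ i (GeometricRealization K) y) := by
  classical
  intro hπ
  have key : ∀ i ≤ N, ∃ u v : (Fin i → ℝ) → V → ℝ, IsEdgeMap R u v ∧
      (∀ x, ‖x‖ = 1 → v x = u (-x)) ∧
      ∀ᶠ M in Filter.atTop, fanParity M (fun x => colorDifference c (u x) (v x)) = 1 := by
    intro i
    induction i with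
    | zero =>
      intro _
      refine ⟨fun _ => Pi.single a₀ 1, fun _ => Pi.single b₀ 1, ⟨continuous_const, continuous_const,
        ⟨{a₀, b₀}, fun _ => ⟨single_mem_weightSimplex (by simp),
          single_mem_weightSimplex (by simp)⟩⟩, fun _ a b ha hb => ?_⟩, fun x hx => ?_, ?_⟩
      · have h1 : a = a₀ := by_contra fun h => ha (Pi.single_eq_of_ne h 1)
        have h2 : b = b₀ := by_contra fun h => hb (Pi.single_eq_of_ne h 1)
        rwa [h1, h2]
      · rw [Subsingleton.elim x 0, norm_zero] at hx
        exact absurd hx zero_ne_one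
      · exact Filter.Eventually.of_forall fun M => fanParity_zero M _
    | succ i ih =>
      intro hi
      obtain ⟨u, v, huv, hanti, hpar⟩ := ih (by omega)
      obtain ⟨u', v', huv', hext⟩ := (huv.double hR hanti).exists_extension hK (hπ i (by omega))
      have hanti' : ∀ x : Fin i → ℝ, ‖x‖ = 1 → v (-x) = u x := fun x hx => by
        rw [hanti _ (by rwa [norm_neg]), neg_neg]
      have hu' : ∀ x : Fin (i + 1) → ℝ, ‖x‖ = 1 →
          u' x = if 0 ≤ x 0 then u (Fin.tail x) else v (-Fin.tail x) := fun x hx =>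
        (hext ⟨x, mem_sphere_zero_iff_norm.2 hx⟩).1
      have hv' : ∀ x : Fin (i + 1) → ℝ, ‖x‖ = 1 →
          v' x = if 0 ≤ x 0 then v (Fin.tail x) else u (-Fin.tail x) := fun x hx =>
        (hext ⟨x, mem_sphere_zero_iff_norm.2 hx⟩).2
      have hside : ∀ x : Fin i → ℝ, ‖x‖ = 1 → ∀ s : ℝ, |s| ≤ 1 →
          u' (Fin.cons s x) = u x ∧ v' (Fin.cons s x) = v x := by
        intro x hx s hs
        have h1 : ‖(Fin.cons s x : Fin (i + 1) → ℝ)‖ = 1 := by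
          rw [norm_finCons, hx, max_eq_right hs]
        rw [hu' _ h1, hv' _ h1, Fin.cons_zero, Fin.tail_cons, hanti' x hx, hanti x hx]
        simp
      refine ⟨u', v', huv', fun x hx => ?_, ?_⟩
      · rw [hv' x hx, hu' (-x) (by rwa [norm_neg])]
        have e : Fin.tail (-x) = -Fin.tail x := rfl
        rw [Pi.neg_apply, e, neg_neg]
        rcases lt_trichotomy (x 0) 0 with h | h | h
        · rw [if_neg (by linarith), if_pos (by linarith)]
        · rw [if_pos h.ge, if_pos (by linarith)]
          refine hanti _ ?_
          rw [← Fin.cons_self_tail x, norm_finCons, h, abs_zero,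
            max_eq_right (norm_nonneg _)] at hx
          exact hx
        · rw [if_pos h.le, if_neg (by linarith)]
      · filter_upwards [hpar, eventually_isFine (huv'.continuous_colorDifference c)
          (huv'.colorDifference_ne_zero hc), Filter.eventually_gt_atTop 0] with M hM hfine hM0
        rw [← hM]
        refine fanParity_succ hM0 (huv.colorDifference_ne_zero hc) hfine ?_ ?_ ?_
        · intro x hx
          have h1 : ‖(Fin.cons 1 x : Fin (i + 1) → ℝ)‖ = 1 := by
            rw [norm_finCons, abs_one, max_eq_left hx]
          rw [hu' _ h1, hv' _ h1]
          simp
        · intro x hx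
          have h1 : ‖(Fin.cons (-1) x : Fin (i + 1) → ℝ)‖ = 1 := by
            rw [norm_finCons, abs_neg, abs_one, max_eq_left hx]
          rw [hu' _ h1, hv' _ h1, ← colorDifference_swap]
          norm_num
        · intro x hx s t hs ht
          simp only [(hside x hx s hs).1, (hside x hx s hs).2, (hside x hx t ht).1,
            (hside x hx t ht).2]
  obtain ⟨u, v, -, -, h⟩ := key N le_rfl
  obtain ⟨M, hM⟩ := h.exists
  rw [fanParity_top] at hM
  exact zero_ne_one hM

end Lovasz

/-! ### Connectivity of complexes with a full skeleton -/

section Skeleton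

open scoped unitInterval

variable {V : Type*} {K : PreAbstractSimplicialComplex V}

/-- If all non-empty sets of at most `i + 2` vertices are faces, then every generalized loop of
dimension `i` is null-homotopic: a simplicial approximation of it, modified so that it is constant
at a vertex `v` on the boundary, involves at most `i + 2` vertices at each point, including `v`, and
is contracted to `v`. -/
theorem GeometricRealization.homotopic_const_of_skeleton {i : ℕ}
    (hK : ∀ τ : Finset V, τ.Nonempty → τ.card ≤ i + 2 → τ ∈ K.faces) {y : GeometricRealization K}
    (f : GenLoop (Fin i) (GeometricRealization K) y) : GenLoop.Homotopic f GenLoop.const := by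
  classical
  have hf : Continuous f := f.1.continuous
  obtain ⟨W₀, hW₀⟩ := GeometricRealization.exists_support_subset hf
  obtain ⟨v, hv⟩ := exists_pos_of_mem_weightSimplex (y.mem_weightSimplex subset_rfl)
  have hvy : v ∈ y.1.support := Finsupp.mem_support_iff.2 hv.ne'
  -- The barycentric coordinates of `f`, extended to all of `ℝⁱ`.
  obtain ⟨r, hr⟩ : ∃ r : (Fin i → ℝ) → Fin i → I,
      r = fun z j => Set.projIcc (0 : ℝ) 1 zero_le_one ((z j + 1) / 2) := ⟨_, rfl⟩
  have hr_c : Continuous r := by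
    rw [hr]
    refine continuous_pi fun j => continuous_projIcc.comp ?_
    fun_prop
  have hr_center : ∀ x, r (cubeCenter x) = x := by
    intro x
    funext j
    simp [hr, cubeCenter]
  obtain ⟨a, ha⟩ : ∃ a : (Fin i → I) → V → ℝ, a = fun x => ((f x).1 : V → ℝ) := ⟨_, rfl⟩
  have ha_c : Continuous a := ha ▸ GeometricRealization.continuous_coe.comp hf
  have ha_W : ∀ x, a x ∈ weightSimplex W₀ := fun x => ha ▸ (f x).mem_weightSimplex (hW₀ x)
  obtain ⟨J, φ, s, hφc, hφ0, hφ1, hcard, hs, -⟩ := exists_simplicial_approximation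
    (ha_c.comp hr_c) fun x => exists_pos_of_mem_weightSimplex (ha_W (r x))
  have hφp : ∀ q, Continuous fun x : Fin i → I => φ q (cubeCenter x) := fun q =>
    (hφc q).comp_continuous continuous_cubeCenter fun x =>
      mem_closedBall_zero_iff.2 (norm_cubeCenter_le x)
  obtain ⟨W, hW₀W, hyW, hJW⟩ : ∃ W, W₀ ⊆ W ∧ y.1.support ⊆ W ∧ J.image s ⊆ W :=
    ⟨W₀ ∪ (y.1.support ∪ J.image s), Finset.subset_union_left,
      Finset.subset_union_left.trans Finset.subset_union_right,
      Finset.subset_union_right.trans Finset.subset_union_right⟩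
  obtain ⟨e, he⟩ : ∃ e : V → ℝ, e = Pi.single v 1 := ⟨_, rfl⟩
  have he_W : e ∈ weightSimplex W := he ▸ single_mem_weightSimplex (hyW hvy)
  have he_ne : ∀ w, e w ≠ 0 → w = v := fun w hw => by
    by_contra hne
    exact hw (he ▸ Pi.single_eq_of_ne hne 1)
  -- The simplicial approximation of `f`.
  obtain ⟨b, hb⟩ : ∃ b : (Fin i → I) → V → ℝ,
      b = fun x => ∑ q ∈ J, φ q (cubeCenter x) • (Pi.single (s q) 1 : V → ℝ) := ⟨_, rfl⟩
  have hb_c : Continuous b := hb ▸ continuous_sum_single s hφp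
  have hb_W : ∀ x, b x ∈ weightSimplex W := fun x => hb ▸ sum_single_mem_weightSimplex
    (fun q => hφ0 q _) (hφ1 _ (norm_cubeCenter_le x)) fun q hq => hJW (Finset.mem_image_of_mem s hq)
  have hb_a : ∀ x w, b x w ≠ 0 → a x w ≠ 0 := by
    intro x w hw
    rw [hb] at hw
    obtain ⟨q, hq, hqx, rfl⟩ := exists_of_sum_single_ne_zero hw
    have := hs q hq _ (norm_cubeCenter_le x) hqx
    rw [Function.comp, hr_center] at this
    exact this.ne'
  -- The cut-off function `χ` is `1` on the boundary and vanishes outside the open star of `v`.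
  obtain ⟨χ, hχ⟩ : ∃ χ : (Fin i → I) → ℝ, χ = fun x => min 1 (a x v / y.1 v) := ⟨_, rfl⟩
  have hχ_c : Continuous χ := by
    have : Continuous fun x => a x v :=
      (_root_.continuous_apply v).comp ha_c
    rw [hχ]
    fun_prop
  have hχ0 : ∀ x, 0 ≤ χ x := fun x => by
    rw [hχ]
    exact le_min zero_le_one (div_nonneg ((ha_W x).1 v) hv.le)
  have hχ1 : ∀ x, χ x ≤ 1 := fun x => by
    rw [hχ]
    exact min_le_left _ _
  have hχ_ne : ∀ x, χ x ≠ 0 → a x v ≠ 0 := by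
    intro x hx h0
    apply hx
    simp [hχ, h0]
  obtain ⟨c, hc⟩ : ∃ c : (Fin i → I) → V → ℝ, c = fun x => χ x • e + (1 - χ x) • b x := ⟨_, rfl⟩
  have hc_c : Continuous c := by
    rw [hc]
    exact (hχ_c.smul continuous_const).add ((continuous_const.sub hχ_c).smul hb_c)
  have hc_W : ∀ x, c x ∈ weightSimplex W := fun x => by
    rw [hc]
    exact convex_weightSimplex W he_W (hb_W x) (hχ0 x) (by linarith [hχ1 x]) (by ring)
  have hc_ne : ∀ x w, c x w ≠ 0 → (w = v ∧ χ x ≠ 0) ∨ b x w ≠ 0 := by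
    intro x w hw
    by_contra! hcon
    apply hw
    simp only [hc, Pi.add_apply, Pi.smul_apply, smul_eq_mul]
    rw [hcon.2, mul_zero, add_zero]
    by_cases hwv : w = v
    · rw [hcon.1 hwv, zero_mul]
    · rw [by_contra fun h => hwv (he_ne w h), mul_zero]
  obtain ⟨α, hα⟩ : ∃ α : I → ℝ, α = fun t : I => min 1 (2 * (t : ℝ)) := ⟨_, rfl⟩
  obtain ⟨β, hβ⟩ : ∃ β : I → ℝ, β = fun t : I => max 0 (2 * (t : ℝ) - 1) := ⟨_, rfl⟩
  have hα_c : Continuous α := by rw [hα]; fun_prop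
  have hβ_c : Continuous β := by rw [hβ]; fun_prop
  have hα01 : ∀ t, 0 ≤ α t ∧ α t ≤ 1 := fun t => by
    rw [hα]
    exact ⟨le_min zero_le_one (by linarith [t.2.1]), min_le_left _ _⟩
  have hβ01 : ∀ t, 0 ≤ β t ∧ β t ≤ 1 := fun t => by
    rw [hβ]
    exact ⟨le_max_left _ _, max_le zero_le_one (by linarith [t.2.2])⟩
  have hαβ : ∀ t, α t = 1 ∨ β t = 0 := by
    intro t
    rw [hα, hβ]
    rcases le_total (1 / 2) (t : ℝ) with h | h
    · exact Or.inl (min_eq_left (by linarith))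
    · exact Or.inr (max_eq_left (by linarith))
  obtain ⟨A, hA⟩ : ∃ A : I × (Fin i → I) → V → ℝ, A = fun p =>
      (1 - α p.1) • a p.2 + α p.1 • ((1 - β p.1) • c p.2 + β p.1 • e) := ⟨_, rfl⟩
  have hA_c : Continuous A := by
    have h1 := hα_c.comp (continuous_fst (X := I) (Y := Fin i → I))
    have h2 := hβ_c.comp (continuous_fst (X := I) (Y := Fin i → I))
    have h3 := ha_c.comp (continuous_snd (X := I) (Y := Fin i → I))
    have h4 := hc_c.comp (continuous_snd (X := I) (Y := Fin i → I))
    rw [hA]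
    exact ((continuous_const.sub h1).smul h3).add
      (h1.smul (((continuous_const.sub h2).smul h4).add (h2.smul continuous_const)))
  have hA_W : ∀ p, A p ∈ weightSimplex W := fun p => by
    rw [hA]
    refine convex_weightSimplex W (weightSimplex_mono hW₀W (ha_W _)) ?_
      (by linarith [hα01 p.1]) (hα01 p.1).1 (by ring)
    exact convex_weightSimplex W (hc_W _) he_W (by linarith [hβ01 p.1]) (hβ01 p.1).1 (by ring)
  have hA_face : ∀ p, ∃ τ ∈ K.faces, ∀ w, A p w ≠ 0 → w ∈ τ := by
    rintro ⟨t, x⟩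
    rcases hαβ t with h | h
    · -- In the second half of the homotopy, at most `i + 2` vertices are involved.
      refine ⟨insert v ((J.filter fun q => φ q (cubeCenter x) ≠ 0).image s),
        hK _ (Finset.insert_nonempty _ _) ?_, fun w hw => ?_⟩
      · refine (Finset.card_insert_le _ _).trans (Nat.succ_le_succ (Finset.card_image_le.trans ?_))
        exact hcard (cubeCenter x) _ (Finset.filter_subset _ _) fun q hq =>
          (Finset.mem_filter.1 hq).2
      · rw [Finset.mem_insert]
        by_contra! hcon
        apply hw
        have h1 : e w = 0 := by_contra fun h => hcon.1 (he_ne w h)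
        have h2 : c x w = 0 := by
          by_contra h
          rcases hc_ne x w h with h | h
          · exact hcon.1 h.1
          · rw [hb] at h
            obtain ⟨q, hq, hqx, rfl⟩ := exists_of_sum_single_ne_zero h
            exact hcon.2 (Finset.mem_image_of_mem s (Finset.mem_filter.2 ⟨hq, hqx⟩))
        simp [hA, h, h1, h2]
    · -- In the first half, the homotopy stays in the supports of `f`.
      refine ⟨(f x).1.support, (f x).2.2.2, fun w hw => Finsupp.mem_support_iff.2 fun h0 => ?_⟩
      have h0 : a x w = 0 := by rw [ha]; exact h0
      apply hw
      have h2 : c x w = 0 := by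
        by_contra h
        rcases hc_ne x w h with h | h
        · exact hχ_ne x h.2 (h.1 ▸ h0)
        · exact hb_a x w h h0
      simp [hA, h, h0, h2]
  obtain ⟨G, hG⟩ : ∃ G : I → V → ℝ, G = fun t => (1 - α t) • (y.1 : V → ℝ) + α t • e := ⟨_, rfl⟩
  have hG_c : Continuous G := by
    rw [hG]
    exact ((continuous_const.sub hα_c).smul continuous_const).add (hα_c.smul continuous_const)
  have hG_W : ∀ t, G t ∈ weightSimplex W := fun t => by
    rw [hG]
    exact convex_weightSimplex W (y.mem_weightSimplex hyW) he_W (by linarith [hα01 t]) (hα01 t).1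
      (by ring)
  have hG_face : ∀ t, ∃ τ ∈ K.faces, ∀ w, G t w ≠ 0 → w ∈ τ := by
    refine fun t => ⟨y.1.support, y.2.2.2, fun w hw => ?_⟩
    by_contra h
    apply hw
    have h1 : e w = 0 := by_contra fun h' => h (he_ne w h' ▸ hvy)
    simp [hG, h1, Finsupp.notMem_support_iff.1 h]
  have hα_zero : α 0 = 0 := by simp [hα]
  have hα_one : α 1 = 1 := by simp [hα]
  have hβ_one : β 1 = 1 := by
    simp [hβ]
    norm_num
  refine GenLoop.homotopic_const_of_homotopy f
    ⟨_, GeometricRealization.continuous_ofWeights hA_c hA_W hA_face⟩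
    ⟨_, GeometricRealization.continuous_ofWeights hG_c hG_W hG_face⟩ (fun x => ?_) (fun x => ?_)
    (fun t x hx => ?_) ?_ <;> refine GeometricRealization.ext fun w => ?_
  · change A (0, x) w = _
    simp [hA, hα_zero, ha]
  · change A (1, x) w = G 1 w
    simp [hA, hG, hα_one, hβ_one]
  · have h1 : a x = y.1 := by
      rw [ha]
      exact congrArg (fun p : GeometricRealization K => (p.1 : V → ℝ)) (f.2 x hx)
    have h2 : χ x = 1 := by
      simp only [hχ, h1]
      rw [div_self hv.ne', min_self]
    have h3 : c x = e := by simp [hc, h2]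
    change A (t, x) w = G t w
    simp only [hA, hG, h1, h3, ← add_smul]
    simp
  · change G 0 w = _
    simp [hG, hα_zero]

theorem GeometricRealization.subsingleton_homotopyGroup_of_skeleton {i : ℕ}
    (hK : ∀ τ : Finset V, τ.Nonempty → τ.card ≤ i + 2 → τ ∈ K.faces) (y : GeometricRealization K) :
    Subsingleton (π_ i (GeometricRealization K) y) :=
  ⟨fun p q => Quotient.inductionOn₂ p q fun f g => Quotient.sound
    ((homotopic_const_of_skeleton hK f).trans (homotopic_const_of_skeleton hK g).symm)⟩

end Skeleton

/-! ### Coverings of the sphere by balls -/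

namespace GeodesicSphere

variable {n : ℕ}

/-- The antipodal map of the sphere. -/
def antipode (x : GeodesicSphere n) : GeodesicSphere n := ⟨-x.1, by rw [norm_neg]; exact x.2⟩

theorem antipode_antipode (x : GeodesicSphere n) : antipode (antipode x) = x :=
  Subtype.ext (neg_neg x.1)

theorem dist_def (x y : GeodesicSphere n) : dist x y = Real.arccos (inner ℝ x.1 y.1) := rfl

theorem dist_antipode (x y : GeodesicSphere n) : dist x (antipode y) = Real.pi - dist x y := by
  rw [dist_def, dist_def, ← Real.arccos_neg, antipode, inner_neg_right]

instance : CompactSpace (GeodesicSphere n) := by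
  have hm : ∀ x : Metric.sphere (0 : EuclideanSpace ℝ (Fin (n + 1))) 1, ‖x.1‖ = 1 := fun x =>
    mem_sphere_zero_iff_norm.1 x.2
  obtain ⟨f, hf⟩ : ∃ f : Metric.sphere (0 : EuclideanSpace ℝ (Fin (n + 1))) 1 → GeodesicSphere n,
      f = fun x => ⟨x.1, hm x⟩ := ⟨_, rfl⟩
  have hc : Continuous f := by
    refine continuous_iff_continuousAt.2 fun x => tendsto_iff_dist_tendsto_zero.2 ?_
    have h : Continuous fun y : Metric.sphere (0 : EuclideanSpace ℝ (Fin (n + 1))) 1 =>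
        Real.arccos (inner ℝ y.1 x.1) :=
      Real.continuous_arccos.comp (continuous_subtype_val.inner continuous_const)
    have h1 := h.tendsto x
    rw [real_inner_self_eq_norm_sq, hm, one_pow, Real.arccos_one] at h1
    subst hf
    exact h1
  have hs : Function.Surjective f := fun y =>
    ⟨⟨y.1, mem_sphere_zero_iff_norm.2 y.2⟩, by subst hf; rfl⟩
  exact hs.compactSpace hc

instance : Nonempty (GeodesicSphere n) := ⟨⟨EuclideanSpace.single 0 1, by simp⟩⟩

theorem isCover_iff {ε : ℝ} (hε : 0 ≤ ε) {C : Set (GeodesicSphere n)} :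
    Metric.IsCover ε.toNNReal Set.univ C ↔ ∀ x, ∃ y ∈ C, dist x y ≤ ε := by
  have h : ∀ x y : GeodesicSphere n, edist x y ≤ ε.toNNReal ↔ dist x y ≤ ε := fun x y => by
    rw [edist_dist, ← ENNReal.ofReal, ENNReal.ofReal_le_ofReal_iff hε]
  simp only [Metric.IsCover, SetRel.IsCover, Set.mem_univ, forall_const]
  refine forall_congr' fun x => exists_congr fun y => and_congr_right fun _ => ?_
  exact h x y

theorem exists_coveringNumber_eq {ε : ℝ} (hε : 0 < ε) : ∃ N : ℕ,
    Metric.coveringNumber ε.toNNReal (Set.univ : Set (GeodesicSphere n)) = N := by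
  obtain ⟨C, hC, hfin, hcov⟩ := Metric.exists_finite_isCover_of_totallyBounded
    (ε := ε.toNNReal) (by simpa using hε) (isCompact_univ (X := GeodesicSphere n)).totallyBounded
  have h := (hcov.coveringNumber_le_encard hC).trans_lt hfin.encard_lt_top
  exact ⟨_, (ENat.natCast_toNat h.ne).symm⟩

theorem exists_forall_lt_dist {ε : ℝ} (hε : 0 ≤ ε) {N : ℕ}
    (hN : Metric.coveringNumber ε.toNNReal (Set.univ : Set (GeodesicSphere n)) = N)
    {σ : Finset (GeodesicSphere n)} (hσ : σ.card < N) : ∃ z, ∀ x ∈ σ, ε < dist z x := by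
  by_contra! h
  have hcov : Metric.IsCover ε.toNNReal Set.univ (σ : Set (GeodesicSphere n)) :=
    (isCover_iff hε).2 h
  have h1 := hcov.coveringNumber_le_encard (Set.subset_univ _)
  rw [hN, Set.encard_coe_eq_coe_finsetCard] at h1
  exact absurd (Nat.cast_le.1 h1) (not_le.2 hσ)

/-- A cover by closed balls of radius `ε` colours the points of the sphere. -/
theorem exists_coloring {ε : ℝ} (hε : 0 ≤ ε) {N : ℕ}
    (hN : Metric.coveringNumber ε.toNNReal (Set.univ : Set (GeodesicSphere n)) = N) :
    0 < N ∧ ∃ c : GeodesicSphere n → Fin N, ∀ x y, c x = c y → dist x y ≤ 2 * ε := by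
  have hN0 : 0 < N := by
    have h := Metric.coveringNumber_pos_iff (ε := ε.toNNReal).2
      (Set.univ_nonempty (α := GeodesicSphere n))
    rw [hN] at h
    exact_mod_cast h
  obtain ⟨C, -, hfin, hcov, hcard⟩ := Metric.exists_set_encard_eq_coveringNumber
    (ε := ε.toNNReal) (A := (Set.univ : Set (GeodesicSphere n)))
    (by rw [hN]; exact ENat.natCast_ne_top N)
  rw [hN] at hcard
  have hC : Nat.card C = N := by
    rw [Nat.card_coe_set_eq, Set.ncard, hcard, ENat.toNat_natCast]
  have : Finite C := hfin
  choose p hpC hp using (isCover_iff hε).1 hcov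
  refine ⟨hN0, fun x => Finite.equivFinOfCardEq hC ⟨p x, hpC x⟩, fun x y hxy => ?_⟩
  have h1 : p x = p y := congrArg Subtype.val ((Finite.equivFinOfCardEq hC).injective hxy)
  have h2 := hp y
  rw [← h1, dist_comm] at h2
  linarith [dist_triangle x (p x) y, hp x]

/-- The Čech complex at scale `π - δ` is the neighbourhood complex of the Borsuk graph, in which two
points are adjacent if their distance is greater than `δ`. -/
theorem mem_faces_cechComplex_iff {δ : ℝ} (σ : Finset (GeodesicSphere n)) :
    σ ∈ (cechComplex (GeodesicSphere n) (Real.pi - δ)).faces ↔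
      σ.Nonempty ∧ ∃ z, ∀ x ∈ σ, δ < dist x z := by
  have h : ∀ z x : GeodesicSphere n, z ∈ Metric.ball x (Real.pi - δ) ↔ δ < dist x (antipode z) := by
    intro z x
    rw [Metric.mem_ball, dist_antipode, dist_comm]
    constructor <;> intro h <;> linarith
  change σ.Nonempty ∧ (⋂ x ∈ σ, Metric.ball x (Real.pi - δ)).Nonempty ↔ _
  refine and_congr_right fun _ => ?_
  constructor
  · rintro ⟨z, hz⟩
    simp only [Set.mem_iInter] at hz
    exact ⟨antipode z, fun x hx => (h z x).1 (hz x hx)⟩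
  · rintro ⟨z, hz⟩
    refine ⟨antipode z, ?_⟩
    simp only [Set.mem_iInter]
    intro x hx
    rw [h, antipode_antipode]
    exact hz x hx

end GeodesicSphere

end

theorem corollary2 (n : ℕ) (hn : 1 ≤ n) (δ : ℝ) (hδ : 0 < δ) (hδπ : δ < Real.pi) :
    ∃ (N₁ N₂ : ℕ) (k : ℤ),
      Metric.coveringNumber δ.toNNReal (Set.univ : Set (GeodesicSphere n)) = N₁ ∧
      Metric.coveringNumber (δ / 2).toNNReal (Set.univ : Set (GeodesicSphere n)) = N₂ ∧
      HasConnectivity (GeometricRealization (cechComplex (GeodesicSphere n) (Real.pi - δ))) k ∧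
      (1 / 2 : ℝ) * N₁ - 2 ≤ k ∧ k ≤ (N₂ : ℤ) - 2 := by
  classical
  obtain ⟨N₁, hN₁⟩ := GeodesicSphere.exists_coveringNumber_eq (n := n) hδ
  obtain ⟨N₂, hN₂⟩ := GeodesicSphere.exists_coveringNumber_eq (n := n) (half_pos hδ)
  have hfaces := GeodesicSphere.mem_faces_cechComplex_iff (n := n) (δ := δ)
  obtain ⟨x₀⟩ : Nonempty (GeodesicSphere n) := inferInstance
  have hx₀ : δ < dist x₀ x₀.antipode := by rwa [GeodesicSphere.dist_antipode, dist_self, sub_zero]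
  have hN₁_two : 2 ≤ N₁ := by
    by_contra h
    -- A single closed ball of radius `δ < π` misses the antipode of its centre.
    obtain ⟨C, -, -, hcov, hcard⟩ := Metric.exists_set_encard_eq_coveringNumber
      (ε := δ.toNNReal) (A := (Set.univ : Set (GeodesicSphere n)))
      (by rw [hN₁]; exact ENat.natCast_ne_top N₁)
    have hle : C.encard ≤ 1 := by
      rw [hcard, hN₁]
      exact_mod_cast (by omega : N₁ ≤ 1)
    have hcov' := (GeodesicSphere.isCover_iff hδ.le).1 hcov
    obtain ⟨c, hc, -⟩ := hcov' x₀
    obtain ⟨c', hc', hd⟩ := hcov' c.antipode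
    rw [Set.encard_le_one_iff.1 hle c' c hc' hc, dist_comm, GeodesicSphere.dist_antipode, dist_self,
      sub_zero] at hd
    linarith
  set Y := GeometricRealization (cechComplex (GeodesicSphere n) (Real.pi - δ)) with hY
  have hne : Nonempty Y :=
    ⟨GeometricRealization.ofWeights (single_mem_weightSimplex (Finset.mem_singleton_self x₀))
      ⟨{x₀}, (hfaces _).2 ⟨Finset.singleton_nonempty _, x₀.antipode, by simpa using hx₀⟩,
        fun v hv => Finset.mem_singleton.2 (by_contra fun h => hv (Pi.single_eq_of_ne h 1))⟩⟩
  set S : Set ℤ := {k : ℤ | ∀ i : ℕ, (i : ℤ) ≤ k → ∀ y : Y, Subsingleton (π_ i Y y)} with hS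
  have hlower : (N₁ : ℤ) - 3 ∈ S := by
    intro i hi y
    refine GeometricRealization.subsingleton_homotopyGroup_of_skeleton (fun σ hσ hcard => ?_) y
    obtain ⟨z, hz⟩ := GeodesicSphere.exists_forall_lt_dist hδ.le hN₁ (σ := σ) (by omega)
    exact (hfaces σ).2 ⟨hσ, z, fun x hx => by rw [dist_comm]; exact hz x hx⟩
  obtain ⟨hN₂_pos, c, hc⟩ := GeodesicSphere.exists_coloring (half_pos hδ).le hN₂
  have hupper : ∀ k ∈ S, k ≤ (N₂ : ℤ) - 2 := by
    intro k hk
    by_contra hlt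
    have : NeZero N₂ := ⟨hN₂_pos.ne'⟩
    refine not_forall_subsingleton_homotopyGroup_of_coloring (R := fun x y => δ < dist x y)
      (fun x y h => by rwa [dist_comm]) (c := c) (fun x y h hxy => ?_) hfaces hx₀
      fun i hi => hk i (by omega)
    have := hc x y hxy
    linarith
  obtain ⟨k, hk, hmax⟩ := Int.exists_greatest_of_bdd ⟨_, hupper⟩ ⟨_, hlower⟩
  refine ⟨N₁, N₂, k, hN₁, hN₂, ⟨hne, hk, hmax⟩, ?_, hupper k hk⟩
  have h1 : (N₁ : ℝ) - 3 ≤ k := by exact_mod_cast hmax _ hlower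
  have h2 : (2 : ℝ) ≤ N₁ := by exact_mod_cast hN₁_two
  linarith
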